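/- Let $W=(W_u)_{u\ge 0}$ be a standard real-valued Brownian motion. For $0\le s<t$ put $h:=t-s$, $W_{s,u}:=W_u-W_s$, let $$H_{s,t}:=\frac1h\int_s^t\Big(W_{s,u}-\frac{u-s}{h}\,W_{s,t}\Big)\,du$$ be the rescaled space-time Lévy area, and let $$L_{s,t}:=\frac16\left(\int_s^t\!\int_s^u\!\int_s^v\circ\,dW_r\circ dW_v\,du-2\int_s^t\!\int_s^u\!\int_s^v\circ\,dW_r\,dv\circ dW_u+\int_s^t\!\int_s^u\!\int_s^v dr\circ dW_v\circ dW_u\right)$$ be the space-space-time Lévy area, where $\circ\,dW$ denotes Stratonovich integration. Then, for all $0\le s<t$, $L_{s,t}$ is square-integrable and, almost surely, $$\mathbb E\big[L_{s,t}\,\big|\,W_{s,t},H_{s,t}\big]=\frac1{30}h^2+\frac35\,h\,H_{s,t}^2,$$ $$\operatorname{Var}\big(L_{s,t}\,\big|\,W_{s,t},H_{s,t}\big)=\frac{11}{25200}h^4+h^3\left(\frac1{720}W_{s,t}^2+\frac1{700}H_{s,t}^2\right).$$ Moreover, $\int_0^1W_u^2\,du$ is square-integrable and, almost surely, $$\operatorname{Var}\left(\int_0^1W_u^2\,du\,\Big|\,W_1,\int_0^1W_u\,du\right)=\frac{11}{6300}+\frac1{180}W_1^2+\frac1{175}\left(\int_0^1W_u\,du-\frac12W_1\right)^2.$$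 -/

import Mathlib

open MeasureTheory ProbabilityTheory Filter
open scoped NNReal

noncomputable section

namespace LevyArea

variable {Ω : Type*} [MeasurableSpace Ω]

/-- The trapezoidal sum of the process `X` against the process `W` along the points
`τ 0, τ 1, …, τ n`, namely `∑ ½ (X_{τ i} + X_{τ (i+1)}) (W_{τ (i+1)} - W_{τ i})`. -/
def trapezoidalSum (W X : ℝ≥0 → Ω → ℝ) (n : ℕ) (τ : ℕ → ℝ≥0) (ω : Ω) : ℝ :=
  ∑ i ∈ Finset.range n,
    (X (τ i) ω + X (τ (i + 1)) ω) / 2 * (W (τ (i + 1)) ω - W (τ i) ω)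

/-- `J` is the Stratonovich integral process `J_u = ∫_s^u X_v ∘ dW_v`, `u ≥ s`: its paths are almost
surely continuous on `[s, ∞)` and, for every `u ≥ s`, the trapezoidal sums along any sequence of
partitions `s = τ_k(0) ≤ … ≤ τ_k(n_k) = u` whose mesh tends to zero converge to `J_u` in
probability. These two properties determine `J` on `[s, ∞)` up to indistinguishability. -/
def IsStratonovichIntegral (P : Measure Ω) (W X : ℝ≥0 → Ω → ℝ) (s : ℝ≥0)
    (J : ℝ≥0 → Ω → ℝ) : Prop :=
  (∀ᵐ ω ∂P, ContinuousOn (fun u ↦ J u ω) (Set.Ici s)) ∧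
  ∀ u, s ≤ u → ∀ (n : ℕ → ℕ) (τ : ℕ → ℕ → ℝ≥0),
    (∀ k, Monotone (τ k) ∧ τ k 0 = s ∧ τ k (n k) = u) →
    (∀ δ : ℝ, 0 < δ → ∀ᶠ k in atTop, ∀ i < n k, (τ k (i + 1) : ℝ) - τ k i < δ) →
    TendstoInMeasure P (fun k ↦ trapezoidalSum W X (n k) (τ k)) atTop (J u)

open Classical in
/-- The Stratonovich integral process `u ↦ ∫_s^u X_v ∘ dW_v` (a continuous version of it, and `0` if
the integral does not exist). -/
def stratonovichIntegral (P : Measure Ω) (W X : ℝ≥0 → Ω → ℝ) (s : ℝ≥0) : ℝ≥0 → Ω → ℝ :=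
  if h : ∃ J, IsStratonovichIntegral P W X s J then h.choose else fun _ _ ↦ 0

/-- The pathwise time integral `u ↦ ∫_s^u X_v dv`. -/
def timeIntegral (X : ℝ≥0 → Ω → ℝ) (s : ℝ≥0) : ℝ≥0 → Ω → ℝ :=
  fun u ω ↦ ∫ v in (s : ℝ)..(u : ℝ), X v.toNNReal ω

/-- The increment `W_{s,t} = W_t - W_s`. -/
def increment (W : ℝ≥0 → Ω → ℝ) (s t : ℝ≥0) (ω : Ω) : ℝ := W t ω - W s ω

/-- The rescaled space-time Lévy area
`H_{s,t} = (1/h) ∫_s^t (W_{s,u} - ((u - s)/h) W_{s,t}) du`, where `h = t - s`. -/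
def spaceTimeLevyArea (W : ℝ≥0 → Ω → ℝ) (s t : ℝ≥0) (ω : Ω) : ℝ :=
  1 / ((t : ℝ) - s) *
    timeIntegral
      (fun u ω ↦ increment W s u ω - ((u : ℝ) - s) / ((t : ℝ) - s) * increment W s t ω) s t ω

/-- The space-space-time Lévy area
`L_{s,t} = (1/6) (∫∫∫ ∘dW_r ∘dW_v du - 2 ∫∫∫ ∘dW_r dv ∘dW_u + ∫∫∫ dr ∘dW_v ∘dW_u)`, where each
triple integral is over `s < r < v < u < t`, iterated from the inside to the outside. -/
def spaceSpaceTimeLevyArea (P : Measure Ω) (W : ℝ≥0 → Ω → ℝ) (s t : ℝ≥0) (ω : Ω) : ℝ :=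
  let dW (X : ℝ≥0 → Ω → ℝ) : ℝ≥0 → Ω → ℝ := stratonovichIntegral P W X s
  let dtime (X : ℝ≥0 → Ω → ℝ) : ℝ≥0 → Ω → ℝ := timeIntegral X s
  let one : ℝ≥0 → Ω → ℝ := fun _ _ ↦ 1
  1 / 6 * (dtime (dW (dW one)) t ω - 2 * dW (dtime (dW one)) t ω + dW (dW (dtime one)) t ω)

/-- The σ-algebra `σ(X, Y)` generated by two real random variables. -/
abbrev sigmaPair (X Y : Ω → ℝ) : MeasurableSpace Ω :=
  MeasurableSpace.comap (fun ω ↦ (X ω, Y ω)) inferInstance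

end LevyArea

end

/-! The Stratonovich integrals need no stochastic calculus. Trapezoidal sums obey an exact summation
by parts, and `∫ W ∘ dW` telescopes, so every iterated integral inside `L` is a pathwise limit for a
continuous path. With `h = t - s`, `w = W_{s,t}`, `A = ∫ W_{s,u} du` and `S = ∫ W_{s,u}² du` this
gives `L = S/2 - A w/2 + h w²/12` almost surely (`spaceSpaceTimeLevyArea_ae_eq`). Brownian scaling
turns this into `h²` times `areaFunctional` of a Brownian motion `B` on `[0, 1]`.

On `[0, 1]` put `H = ∫ B - B_1/2` and write `B_u = u B_1 + 6u(1-u) H + Z_u`. The coefficients are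
the regression coefficients of `B_u` on the uncorrelated pair `(B_1, H)`. As `B` and its time
integral are jointly Gaussian (`isGaussianProcess_withIntegral`), the residual `Z` is independent of
`(B_1, H)` (`indep_residualSigma`). Its covariance is `K(u,v) = min u v - uv - 3u(1-u)v(1-v)`.
Substitution (`areaFunctional_eq`) gives `3/5 H² + B_1 ∫ u Z_u du + H ∫ 6u(1-u) Z_u du + 1/2 ∫ Z_u²
du`, a sum of products of a known factor with an independent one. Its conditional mean and variance
are therefore read off from the means and covariances of the second factors
(`condExp_condVar_sum_mul`). Fubini and Wick's formula reduce these to polynomial integrals of `K`: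
the two linear integrals have variances `1/720` and `1/700` and are uncorrelated, the quadratic one
has mean `1/30` and variance `11/25200`, and odd Gaussian moments remove the remaining covariances.

Finally `∫ W²` on `[0, 1]` is twice the area functional plus a function of `(W_1, ∫ W)`. The latter
does not affect the conditional variance, which is thus multiplied by four. -/

noncomputable section

namespace LevyArea

open scoped Topology

/-! ### Pathwise limits of trapezoidal sums -/

section

/-- The trapezoidal sum of the function `f` against the function `g` along `τ 0, …, τ n`. -/
def trapezoid (f g : ℝ≥0 → ℝ) (n : ℕ) (τ : ℕ → ℝ≥0) : ℝ :=
  ∑ i ∈ Finset.range n, (f (τ i) + f (τ (i + 1))) / 2 * (g (τ (i + 1)) - g (τ i))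

/-- A sequence of partitions `s = τ k 0 ≤ … ≤ τ k (n k) = u` whose mesh tends to zero. -/
structure IsPartitionSeq (s u : ℝ≥0) (n : ℕ → ℕ) (τ : ℕ → ℕ → ℝ≥0) : Prop where
  partition : ∀ k, Monotone (τ k) ∧ τ k 0 = s ∧ τ k (n k) = u
  mesh : ∀ δ : ℝ, 0 < δ → ∀ᶠ k in atTop, ∀ i < n k, (τ k (i + 1) : ℝ) - τ k i < δ

/-- Summation by parts is exact for trapezoidal weights, with no quadratic covariation term; this is
the discrete Stratonovich product rule. -/
lemma trapezoid_add_comm (f g : ℝ≥0 → ℝ) (n : ℕ) (τ : ℕ → ℝ≥0) :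
    trapezoid f g n τ + trapezoid g f n τ = f (τ n) * g (τ n) - f (τ 0) * g (τ 0) := by
  unfold trapezoid
  induction n with
  | zero => simp
  | succ n ih =>
    rw [Finset.sum_range_succ, Finset.sum_range_succ]
    linear_combination ih

lemma continuous_comp_toNNReal {f : ℝ≥0 → ℝ} (hf : Continuous f) :
    Continuous fun v : ℝ ↦ f v.toNNReal :=
  hf.comp continuous_real_toNNReal

lemma continuous_integral_toNNReal {f : ℝ≥0 → ℝ} (hf : Continuous f) (s : ℝ) :
    Continuous fun u : ℝ≥0 ↦ ∫ v in s..(u : ℝ), f v.toNNReal :=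
  (intervalIntegral.continuous_primitive
    (fun a b ↦ (continuous_comp_toNNReal hf).intervalIntegrable a b) s).comp
      NNReal.continuous_coe

namespace IsPartitionSeq

variable {s u : ℝ≥0} {n : ℕ → ℕ} {τ : ℕ → ℕ → ℝ≥0}

lemma mem_Icc (h : IsPartitionSeq s u n τ) {k i : ℕ} (hi : i ≤ n k) : τ k i ∈ Set.Icc s u := by
  obtain ⟨hm, h0, hn⟩ := h.partition k
  exact ⟨h0 ▸ hm (Nat.zero_le i), hn ▸ hm hi⟩

lemma le (h : IsPartitionSeq s u n τ) : s ≤ u := by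
  have := h.mem_Icc (k := 0) (Nat.zero_le _)
  exact this.1.trans this.2

/-- The oscillation of a continuous function over the intervals of a partition tends to zero with
the mesh. -/
lemma eventually_osc_lt (h : IsPartitionSeq s u n τ) {g : ℝ≥0 → ℝ} (hg : Continuous g)
    {ε : ℝ} (hε : 0 < ε) :
    ∀ᶠ k in atTop, ∀ i < n k, ∀ x ∈ Set.Icc (τ k i) (τ k (i + 1)),
      ∀ y ∈ Set.Icc (τ k i) (τ k (i + 1)), |g x - g y| < ε := by
  have huc : UniformContinuousOn g (Set.Icc s u) :=
    isCompact_Icc.uniformContinuousOn_of_continuous hg.continuousOn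
  obtain ⟨δ, hδ, H⟩ := Metric.uniformContinuousOn_iff.1 huc ε hε
  filter_upwards [h.mesh δ hδ] with k hk i hi x hx y hy
  have hl := h.mem_Icc (k := k) hi.le
  have hr := h.mem_Icc (k := k) (Nat.succ_le_of_lt hi)
  have := H x ⟨hl.1.trans hx.1, hx.2.trans hr.2⟩ y ⟨hl.1.trans hy.1, hy.2.trans hr.2⟩ ?_
  · rwa [Real.dist_eq] at this
  · have hx1 := NNReal.coe_le_coe.2 hx.1
    have hx2 := NNReal.coe_le_coe.2 hx.2
    have hy1 := NNReal.coe_le_coe.2 hy.1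
    have hy2 := NNReal.coe_le_coe.2 hy.2
    rw [NNReal.dist_eq, abs_lt]
    constructor <;> linarith [hk i hi]

lemma sum_sub (h : IsPartitionSeq s u n τ) (k : ℕ) (F : ℝ≥0 → ℝ) :
    ∑ i ∈ Finset.range (n k), (F (τ k (i + 1)) - F (τ k i)) = F u - F s := by
  obtain ⟨-, h0, hn⟩ := h.partition k
  rw [Finset.sum_range_sub (fun i ↦ F (τ k i)), h0, hn]

/-- Trapezoidal sums against a `C¹` integrator converge to the Riemann integral. -/
lemma tendsto_trapezoid (h : IsPartitionSeq s u n τ) {g f F : ℝ≥0 → ℝ} (hg : Continuous g)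
    (hf : Continuous f) (hF : ∀ a b : ℝ≥0, F b - F a = ∫ v in (a : ℝ)..b, f v.toNNReal) :
    Tendsto (fun k ↦ trapezoid g F (n k) (τ k)) atTop
      (𝓝 (∫ v in (s : ℝ)..u, g v.toNNReal * f v.toNNReal)) := by
  have hg' := continuous_comp_toNNReal hg
  have hf' := continuous_comp_toNNReal hf
  have hgf : Continuous fun v : ℝ ↦ g v.toNNReal * f v.toNNReal := hg'.mul hf'
  obtain ⟨C, hC⟩ := (isCompact_Icc (a := s) (b := u)).exists_bound_of_continuousOn hf.continuousOn
  have hC0 : 0 ≤ C := (norm_nonneg _).trans (hC s ⟨le_rfl, h.le⟩)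
  rw [Metric.tendsto_atTop']
  intro ε hε
  have hus : (0 : ℝ) ≤ u - s := sub_nonneg.2 (NNReal.coe_le_coe.2 h.le)
  -- The total error will be at most `η * C * (u - s)`; the `+ 1` keeps the denominator positive
  -- when `C` or `u - s` vanishes.
  set η : ℝ := ε / (2 * (C * (u - s) + 1)) with hη
  have hη0 : 0 < η := by positivity
  obtain ⟨N, hN⟩ := eventually_atTop.1 (h.eventually_osc_lt hg hη0)
  refine ⟨N, fun k hk ↦ ?_⟩
  have hosc := hN k hk.le
  obtain ⟨hm, h0, hn⟩ := h.partition k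
  have hsum : ∫ v in (s : ℝ)..u, g v.toNNReal * f v.toNNReal =
      ∑ i ∈ Finset.range (n k),
        ∫ v in (τ k i : ℝ)..(τ k (i + 1) : ℝ), g v.toNNReal * f v.toNNReal := by
    rw [intervalIntegral.sum_integral_adjacent_intervals (a := fun i ↦ (τ k i : ℝ))
      (fun i _ ↦ hgf.intervalIntegrable _ _), h0, hn]
  rw [Real.dist_eq, hsum, trapezoid, ← Finset.sum_sub_distrib]
  calc |∑ i ∈ Finset.range (n k), ((g (τ k i) + g (τ k (i + 1))) / 2 * (F (τ k (i + 1)) - F (τ k i))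
          - ∫ v in (τ k i : ℝ)..(τ k (i + 1) : ℝ), g v.toNNReal * f v.toNNReal)|
      ≤ ∑ i ∈ Finset.range (n k), η * C * ((τ k (i + 1) : ℝ) - τ k i) := by
        refine (Finset.abs_sum_le_sum_abs _ _).trans (Finset.sum_le_sum fun i hi ↦ ?_)
        have hi' := Finset.mem_range.1 hi
        have hle : τ k i ≤ τ k (i + 1) := hm (Nat.le_succ i)
        have hle' : (τ k i : ℝ) ≤ τ k (i + 1) := NNReal.coe_le_coe.2 hle
        rw [hF, ← intervalIntegral.integral_const_mul,
          ← intervalIntegral.integral_sub ((hf'.const_mul _).intervalIntegrable _ _)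
            (hgf.intervalIntegrable _ _)]
        have := intervalIntegral.norm_integral_le_of_norm_le_const (a := (τ k i : ℝ))
          (b := τ k (i + 1)) (C := η * C)
          (f := fun v ↦ (g (τ k i) + g (τ k (i + 1))) / 2 * f v.toNNReal
            - g v.toNNReal * f v.toNNReal) ?_
        · rwa [Real.norm_eq_abs, abs_of_nonneg (sub_nonneg.2 hle')] at this
        · intro v hv
          rw [Set.uIoc_of_le hle'] at hv
          have hv1 : τ k i ≤ v.toNNReal := by
            rw [← Real.toNNReal_coe (r := τ k i)]; exact Real.toNNReal_le_toNNReal hv.1.le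
          have hv2 : v.toNNReal ≤ τ k (i + 1) := Real.toNNReal_le_iff_le_coe.2 hv.2
          -- `g v` lies within `η` of both endpoint values, hence of their average.
          have e1 := hosc i hi' _ ⟨le_rfl, hle⟩ v.toNNReal ⟨hv1, hv2⟩
          have e2 := hosc i hi' _ ⟨hle, le_rfl⟩ v.toNNReal ⟨hv1, hv2⟩
          have hfb := hC v.toNNReal ⟨(h.mem_Icc hi'.le).1.trans hv1,
            hv2.trans (h.mem_Icc (Nat.succ_le_of_lt hi')).2⟩
          rw [← sub_mul, norm_mul]
          refine mul_le_mul ?_ hfb (norm_nonneg _) hη0.le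
          rw [abs_lt] at e1 e2
          rw [Real.norm_eq_abs, abs_le]
          constructor <;> linarith
    _ = η * C * (u - s) := by
        rw [← Finset.mul_sum, h.sum_sub k (fun x ↦ (x : ℝ))]
    _ < ε := by
        have hD : 0 < C * (u - s) + 1 := by positivity
        have : η * (2 * (C * (u - s) + 1)) = ε := by rw [hη]; field_simp
        nlinarith

/-- Summation by parts moves the roughness from the integrator to the integrand, so `g` need only be
continuous. -/
lemma tendsto_trapezoid_of_integrand (h : IsPartitionSeq s u n τ) {g f F : ℝ≥0 → ℝ}
    (hg : Continuous g) (hf : Continuous f)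
    (hF : ∀ a b : ℝ≥0, F b - F a = ∫ v in (a : ℝ)..b, f v.toNNReal) :
    Tendsto (fun k ↦ trapezoid F g (n k) (τ k)) atTop
      (𝓝 (F u * g u - F s * g s - ∫ v in (s : ℝ)..u, g v.toNNReal * f v.toNNReal)) := by
  have e : (fun k ↦ trapezoid F g (n k) (τ k)) =
      fun k ↦ F u * g u - F s * g s - trapezoid g F (n k) (τ k) := by
    ext k
    obtain ⟨-, h0, hn⟩ := h.partition k
    have := trapezoid_add_comm F g (n k) (τ k)
    rw [h0, hn] at this
    linarith
  rw [e]
  exact (h.tendsto_trapezoid hg hf hF).const_sub _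

/-- The product of a `C¹` function and `w`, integrated against `w`: no correction term arises for
trapezoidal sums, whatever the roughness of `w`. -/
lemma tendsto_trapezoid_mul_self (h : IsPartitionSeq s u n τ) {w : ℝ≥0 → ℝ} (hw : Continuous w) :
    Tendsto (fun k ↦ trapezoid (fun v ↦ ((v : ℝ) - s) * w v) w (n k) (τ k)) atTop
      (𝓝 (((u : ℝ) - s) * (w u ^ 2 / 2) - ∫ v in (s : ℝ)..u, w v.toNNReal ^ 2 / 2)) := by
  have hlim := h.tendsto_trapezoid_of_integrand (g := fun v ↦ w v ^ 2 / 2) (f := fun _ ↦ 1)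
    (F := fun v ↦ (v : ℝ) - s) (by fun_prop) continuous_const (by intro a b; simp)
  simp only [sub_self, zero_mul, sub_zero, mul_one] at hlim
  -- Interval by interval, the sum differs from that of `v - s` against `w²/2` by exactly `Δv
  -- (Δw)²/4`. These remainders add up to at most `u - s` times the largest squared oscillation,
  -- which vanishes by continuity alone.
  have e : (fun k ↦ trapezoid (fun v ↦ ((v : ℝ) - s) * w v) w (n k) (τ k)) =
      fun k ↦ trapezoid (fun v ↦ (v : ℝ) - s) (fun v ↦ w v ^ 2 / 2) (n k) (τ k) +
        ∑ i ∈ Finset.range (n k),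
          ((τ k (i + 1) : ℝ) - τ k i) * ((w (τ k (i + 1)) - w (τ k i)) ^ 2 / 4) := by
    ext k
    rw [trapezoid, trapezoid, ← Finset.sum_add_distrib]
    exact Finset.sum_congr rfl fun i _ ↦ by ring
  rw [e]
  have hrem : Tendsto (fun k ↦ ∑ i ∈ Finset.range (n k),
      ((τ k (i + 1) : ℝ) - τ k i) * ((w (τ k (i + 1)) - w (τ k i)) ^ 2 / 4)) atTop (𝓝 0) := by
    rw [Metric.tendsto_atTop']
    intro ε hε
    have hus : (0 : ℝ) ≤ u - s := sub_nonneg.2 (NNReal.coe_le_coe.2 h.le)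
    set η : ℝ := ε / (((u : ℝ) - s) + 1) with hη
    have hη0 : 0 < η := by positivity
    obtain ⟨N, hN⟩ := eventually_atTop.1 (h.eventually_osc_lt hw (Real.sqrt_pos.2 hη0))
    refine ⟨N, fun k hk ↦ ?_⟩
    obtain ⟨hm, h0, hn⟩ := h.partition k
    have hnn (i : ℕ) : (0 : ℝ) ≤ (τ k (i + 1) : ℝ) - τ k i :=
      sub_nonneg.2 (NNReal.coe_le_coe.2 (hm (Nat.le_succ i)))
    rw [Real.dist_eq, sub_zero, abs_of_nonneg
      (Finset.sum_nonneg fun i _ ↦ mul_nonneg (hnn i) (by positivity))]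
    calc _ ≤ ∑ i ∈ Finset.range (n k), ((τ k (i + 1) : ℝ) - τ k i) * η := by
          refine Finset.sum_le_sum fun i hi ↦ mul_le_mul_of_nonneg_left ?_ (hnn i)
          have hle := hm (Nat.le_succ i)
          have := hN k hk.le i (Finset.mem_range.1 hi) _ ⟨hle, le_rfl⟩ _ ⟨le_rfl, hle⟩
          have h2 := pow_lt_pow_left₀ this (abs_nonneg _) two_ne_zero
          rw [sq_abs, Real.sq_sqrt hη0.le] at h2
          have := sq_nonneg (w (τ k (i + 1)) - w (τ k i))
          simp only [Nat.succ_eq_add_one] at h2 ⊢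
          linarith
      _ = (u - s) * η := by rw [← Finset.sum_mul, h.sum_sub k (fun x ↦ (x : ℝ))]
      _ < ε := by
          have : η * ((u - s) + 1) = ε := by rw [hη]; field_simp
          nlinarith
  have := hlim.add hrem
  rwa [add_zero] at this

end IsPartitionSeq

/-- The uniform partition of `[s, u]` into `k + 1` intervals. -/
def uniformPartition (s u : ℝ≥0) (k i : ℕ) : ℝ≥0 :=
  s + min ((i : ℝ≥0) / (k + 1)) 1 * (u - s)

lemma isPartitionSeq_uniformPartition {s u : ℝ≥0} (h : s ≤ u) :
    IsPartitionSeq s u (fun k ↦ k + 1) (uniformPartition s u) where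
  partition k := by
    refine ⟨fun i j hij ↦ ?_, by simp [uniformPartition], ?_⟩
    · unfold uniformPartition
      gcongr
    · simp [uniformPartition, h]
  mesh δ hδ := by
    have hlim : Tendsto (fun k : ℕ ↦ ((u - s : ℝ≥0) : ℝ) * (1 / ((k : ℝ) + 1))) atTop (𝓝 0) := by
      simpa using (tendsto_one_div_add_atTop_nhds_zero_nat (𝕜 := ℝ)).const_mul _
    filter_upwards [hlim.eventually_lt_const hδ] with k hk i hi
    refine lt_of_le_of_lt ?_ hk
    -- The truncation at `1` serves to make the partition monotone on all of `ℕ`; it is inactive for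
    -- the indices that count.
    have hcoe (j : ℕ) (hj : j ≤ k + 1) :
        (uniformPartition s u k j : ℝ) = s + j / (k + 1) * (u - s : ℝ≥0) := by
      have h1 : (j : ℝ≥0) / (k + 1) ≤ 1 := by
        rw [div_le_one (by positivity)]
        exact_mod_cast hj
      simp [uniformPartition, min_eq_left h1]
    rw [hcoe _ hi, hcoe _ hi.le]
    apply le_of_eq
    push_cast
    field_simp
    ring

end

/-! ### Identification of the Stratonovich integrals and of the Lévy area -/

section

variable {Ω : Type*}

/-- Used to pass from almost sure equality at each fixed time to indistinguishability: countably
many times are enough for continuous paths. -/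
lemma eqOn_Ici_of_dense {s : ℝ≥0} {f g : ℝ≥0 → ℝ} (hf : ContinuousOn f (Set.Ici s))
    (hg : ContinuousOn g (Set.Ici s))
    (h : ∀ n, f (s + TopologicalSpace.denseSeq ℝ≥0 n) = g (s + TopologicalSpace.denseSeq ℝ≥0 n)) :
    Set.EqOn f g (Set.Ici s) := by
  have hs : Continuous fun x : ℝ≥0 ↦ s + x := by fun_prop
  have hm (x : ℝ≥0) : s + x ∈ Set.Ici s := Set.mem_Ici.2 le_self_add
  have := Continuous.ext_on (TopologicalSpace.denseRange_denseSeq ℝ≥0)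
    (hf.comp_continuous hs hm) (hg.comp_continuous hs hm) (by rintro _ ⟨n, rfl⟩; exact h n)
  intro u hu
  have h1 := congrFun this (u - s)
  simpa only [Function.comp_apply, add_tsub_cancel_of_le (Set.mem_Ici.1 hu)] using h1

lemma trapezoid_sub_left (f f' g : ℝ≥0 → ℝ) (n : ℕ) (τ : ℕ → ℝ≥0) :
    trapezoid (fun v ↦ f v - f' v) g n τ = trapezoid f g n τ - trapezoid f' g n τ := by
  rw [trapezoid, trapezoid, trapezoid, ← Finset.sum_sub_distrib]
  exact Finset.sum_congr rfl fun i _ ↦ by ring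

lemma trapezoid_increment (f : ℝ≥0 → ℝ) (W : ℝ≥0 → Ω → ℝ) (s : ℝ≥0) (ω : Ω) (n : ℕ)
    (τ : ℕ → ℝ≥0) :
    trapezoid f (W · ω) n τ = trapezoid f (fun v ↦ increment W s v ω) n τ := by
  simp [trapezoid, increment]

lemma timeIntegral_congr {X Y : ℝ≥0 → Ω → ℝ} {s u : ℝ≥0} {ω : Ω} (hsu : s ≤ u)
    (h : ∀ v, s ≤ v → X v ω = Y v ω) : timeIntegral X s u ω = timeIntegral Y s u ω := by
  refine intervalIntegral.integral_congr fun v hv ↦ h _ ?_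
  rw [Set.uIcc_of_le (NNReal.coe_le_coe.2 hsu)] at hv
  rw [← Real.toNNReal_coe (r := s)]
  exact Real.toNNReal_le_toNNReal hv.1

lemma timeIntegral_sub_timeIntegral {X : ℝ≥0 → Ω → ℝ} {ω : Ω} (h : Continuous fun u ↦ X u ω)
    (s a b : ℝ≥0) :
    timeIntegral X s b ω - timeIntegral X s a ω = ∫ v in (a : ℝ)..b, X v.toNNReal ω :=
  have h' := continuous_comp_toNNReal h
  intervalIntegral.integral_interval_sub_left (h'.intervalIntegrable _ _)
    (h'.intervalIntegrable _ _)

lemma continuous_timeIntegral {s : ℝ≥0} {X : ℝ≥0 → Ω → ℝ} {ω : Ω} (h : Continuous fun u ↦ X u ω) :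
    Continuous fun u ↦ timeIntegral X s u ω :=
  continuous_integral_toNNReal h s

variable [MeasurableSpace Ω]

lemma ae_continuous_increment {P : Measure Ω} {W : ℝ≥0 → Ω → ℝ} (hc : ∀ᵐ ω ∂P, Continuous (W · ω))
    (s : ℝ≥0) :
    ∀ᵐ ω ∂P, Continuous fun v ↦ increment W s v ω := by
  filter_upwards [hc] with ω h
  exact h.sub continuous_const

lemma measurable_timeIntegral {X : ℝ≥0 → Ω → ℝ} (hX : Measurable (Function.uncurry X))
    (s u : ℝ≥0) : Measurable (timeIntegral X s u) := by
  have h : StronglyMeasurable (Function.uncurry fun (ω : Ω) (v : ℝ) ↦ X v.toNNReal ω) :=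
    (hX.comp ((measurable_real_toNNReal.comp measurable_snd).prodMk
      measurable_fst)).stronglyMeasurable
  unfold timeIntegral intervalIntegral
  exact (h.integral_prod_right.sub h.integral_prod_right).measurable

lemma measurable_increment {W : ℝ≥0 → Ω → ℝ} (hW : Measurable (Function.uncurry W)) (s : ℝ≥0) :
    Measurable (Function.uncurry (increment W s)) :=
  hW.sub (hW.comp (measurable_const.prodMk measurable_snd))

lemma measurable_eval_of_uncurry {X : ℝ≥0 → Ω → ℝ} (hX : Measurable (Function.uncurry X))
    (u : ℝ≥0) : Measurable (X u) :=
  hX.comp (measurable_const.prodMk measurable_id)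

variable {P : Measure Ω} [IsProbabilityMeasure P]

/-- A process whose paths are the pathwise limits of trapezoidal sums is, up to
indistinguishability, the Stratonovich integral. -/
lemma stratonovichIntegral_ae_eq {W X X' J : ℝ≥0 → Ω → ℝ} {s : ℝ≥0}
    (hW : ∀ u, Measurable (W u)) (hX : ∀ᵐ ω ∂P, ∀ u, s ≤ u → X u ω = X' u ω)
    (hX' : ∀ u, Measurable (X' u)) (hJ : ∀ᵐ ω ∂P, Continuous fun u ↦ J u ω)
    (hlim : ∀ᵐ ω ∂P, ∀ u n τ, IsPartitionSeq s u n τ →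
      Tendsto (fun k ↦ trapezoid (X' · ω) (W · ω) (n k) (τ k)) atTop (𝓝 (J u ω))) :
    ∀ᵐ ω ∂P, ∀ u, s ≤ u → stratonovichIntegral P W X s u ω = J u ω := by
  have key : ∀ u n τ, IsPartitionSeq s u n τ →
      TendstoInMeasure P (fun k ↦ trapezoidalSum W X (n k) (τ k)) atTop (J u) := by
    intro u n τ h
    have hae : ∀ k, (fun ω ↦ trapezoid (X' · ω) (W · ω) (n k) (τ k)) =ᵐ[P]
        trapezoidalSum W X (n k) (τ k) := by
      intro k
      filter_upwards [hX] with ω hω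
      refine Finset.sum_congr rfl fun i hi ↦ ?_
      have hi := Finset.mem_range.1 hi
      dsimp only
      rw [hω _ (h.mem_Icc hi.le).1, hω _ (h.mem_Icc (Nat.succ_le_of_lt hi)).1]
    refine TendstoInMeasure.congr_left hae (tendstoInMeasure_of_tendsto_ae (fun k ↦ ?_) ?_)
    · refine Measurable.aestronglyMeasurable ?_
      unfold trapezoid
      refine Finset.measurable_sum _ fun i _ ↦ ?_
      exact (((hX' _).add (hX' _)).div_const 2).mul ((hW _).sub (hW _))
    · filter_upwards [hlim] with ω hω using hω u n τ h
  have hex : IsStratonovichIntegral P W X s J :=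
    ⟨hJ.mono fun ω h ↦ h.continuousOn, fun u _ n τ h1 h2 ↦ key u n τ ⟨h1, h2⟩⟩
  have hex' : ∃ J, IsStratonovichIntegral P W X s J := ⟨J, hex⟩
  -- The process picked by choice is known only through its defining property; uniqueness of limits
  -- in probability along uniform partitions then identifies it with `J` at each time.
  obtain ⟨hc, hK⟩ : IsStratonovichIntegral P W X s (stratonovichIntegral P W X s) := by
    unfold stratonovichIntegral
    rw [dif_pos hex']
    exact hex'.choose_spec
  have heq : ∀ u, s ≤ u → stratonovichIntegral P W X s u =ᵐ[P] J u := fun u hu ↦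
    have hp := isPartitionSeq_uniformPartition hu
    tendstoInMeasure_ae_unique (hK u hu _ _ hp.partition hp.mesh) (key u _ _ hp)
  have hall : ∀ᵐ ω ∂P, ∀ n, stratonovichIntegral P W X s
      (s + TopologicalSpace.denseSeq ℝ≥0 n) ω = J (s + TopologicalSpace.denseSeq ℝ≥0 n) ω :=
    ae_all_iff.2 fun n ↦ heq _ le_self_add
  filter_upwards [hc, hJ, hall] with ω h1 h2 h3 u hu
  exact eqOn_Ici_of_dense h1 h2.continuousOn h3 hu

section Representation

variable {W : ℝ≥0 → Ω → ℝ} {s : ℝ≥0}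

lemma stratonovichIntegral_one (hWm : Measurable (Function.uncurry W))
    (hc : ∀ᵐ ω ∂P, Continuous (W · ω)) :
    ∀ᵐ ω ∂P, ∀ u, s ≤ u → stratonovichIntegral P W (fun _ _ ↦ 1) s u ω = increment W s u ω := by
  refine stratonovichIntegral_ae_eq (X' := fun _ _ ↦ 1) (measurable_eval_of_uncurry hWm)
    (by simp) (fun _ ↦ measurable_const) (ae_continuous_increment hc s)
    (.of_forall fun ω u n τ h ↦ ?_)
  refine tendsto_const_nhds.congr fun k ↦ ?_
  rw [trapezoid, increment, ← h.sum_sub k (W · ω)]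
  exact Finset.sum_congr rfl fun i _ ↦ by ring

/-- Since `(a + b)/2 * (b - a) = (b² - a²)/2`, every trapezoidal sum already equals the limit. -/
lemma stratonovichIntegral_increment (hWm : Measurable (Function.uncurry W))
    (hc : ∀ᵐ ω ∂P, Continuous (W · ω)) {X : ℝ≥0 → Ω → ℝ}
    (hX : ∀ᵐ ω ∂P, ∀ u, s ≤ u → X u ω = increment W s u ω) :
    ∀ᵐ ω ∂P, ∀ u, s ≤ u → stratonovichIntegral P W X s u ω = increment W s u ω ^ 2 / 2 := by
  refine stratonovichIntegral_ae_eq (measurable_eval_of_uncurry hWm) hX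
    (measurable_eval_of_uncurry (measurable_increment hWm s)) ?_ (.of_forall fun ω u n τ h ↦ ?_)
  · filter_upwards [ae_continuous_increment hc s] with ω hω using (hω.pow 2).div_const 2
  · refine tendsto_const_nhds.congr fun k ↦ ?_
    have e := h.sum_sub k (fun v ↦ increment W s v ω ^ 2 / 2)
    rw [show increment W s s ω ^ 2 / 2 = 0 by simp [increment], sub_zero] at e
    rw [trapezoid, ← e]
    refine Finset.sum_congr rfl fun i _ ↦ ?_
    simp only [increment]
    ring

/-- The integrand is `C¹` with derivative `W_{s,·}`, so integration by parts applies pathwise. -/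
lemma stratonovichIntegral_timeIntegral_increment (hWm : Measurable (Function.uncurry W))
    (hc : ∀ᵐ ω ∂P, Continuous (W · ω)) {X : ℝ≥0 → Ω → ℝ}
    (hX : ∀ᵐ ω ∂P, ∀ u, s ≤ u → X u ω = timeIntegral (increment W s) s u ω) :
    ∀ᵐ ω ∂P, ∀ u, s ≤ u → stratonovichIntegral P W X s u ω =
      timeIntegral (increment W s) s u ω * increment W s u ω
        - timeIntegral (fun v ω ↦ increment W s v ω ^ 2) s u ω := by
  refine stratonovichIntegral_ae_eq (measurable_eval_of_uncurry hWm) hX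
    (fun u ↦ measurable_timeIntegral (measurable_increment hWm s) s u) ?_ ?_
  · filter_upwards [ae_continuous_increment hc s] with ω hω
    exact ((continuous_timeIntegral hω).mul hω).sub
      (continuous_timeIntegral (X := fun v ω ↦ increment W s v ω ^ 2) (hω.pow 2))
  · filter_upwards [ae_continuous_increment hc s] with ω hω u n τ h
    have := h.tendsto_trapezoid_of_integrand hω hω
      (F := fun u ↦ timeIntegral (increment W s) s u ω)
      (fun a b ↦ timeIntegral_sub_timeIntegral hω s a b)
    simp only [trapezoid_increment _ W s ω]
    convert this using 2
    simp [timeIntegral, pow_two]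

lemma stratonovichIntegral_time (hWm : Measurable (Function.uncurry W))
    (hc : ∀ᵐ ω ∂P, Continuous (W · ω)) {X : ℝ≥0 → Ω → ℝ}
    (hX : ∀ᵐ ω ∂P, ∀ u, s ≤ u → X u ω = (u : ℝ) - s) :
    ∀ᵐ ω ∂P, ∀ u, s ≤ u → stratonovichIntegral P W X s u ω =
      ((u : ℝ) - s) * increment W s u ω - timeIntegral (increment W s) s u ω := by
  refine stratonovichIntegral_ae_eq (X' := fun u _ ↦ (u : ℝ) - s)
    (measurable_eval_of_uncurry hWm) hX (fun u ↦ measurable_const) ?_ ?_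
  · filter_upwards [ae_continuous_increment hc s] with ω hω
    exact ((NNReal.continuous_coe.sub continuous_const).mul hω).sub (continuous_timeIntegral hω)
  · filter_upwards [ae_continuous_increment hc s] with ω hω u n τ h
    have := h.tendsto_trapezoid_of_integrand hω (f := fun _ ↦ 1)
      (F := fun u ↦ (u : ℝ) - s) continuous_const (by intro a b; simp)
    simp only [trapezoid_increment _ W s ω]
    convert this using 2
    simp [timeIntegral]

/-- The two parts of the integrand are treated separately: the product of time and path by
`tendsto_trapezoid_mul_self`, the time integral by parts. -/
lemma stratonovichIntegral_time_time (hWm : Measurable (Function.uncurry W))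
    (hc : ∀ᵐ ω ∂P, Continuous (W · ω)) {X : ℝ≥0 → Ω → ℝ}
    (hX : ∀ᵐ ω ∂P, ∀ u, s ≤ u → X u ω =
      ((u : ℝ) - s) * increment W s u ω - timeIntegral (increment W s) s u ω) :
    ∀ᵐ ω ∂P, ∀ u, s ≤ u → stratonovichIntegral P W X s u ω =
      ((u : ℝ) - s) * (increment W s u ω ^ 2 / 2)
        + timeIntegral (fun v ω ↦ increment W s v ω ^ 2) s u ω / 2
        - timeIntegral (increment W s) s u ω * increment W s u ω := by
  refine stratonovichIntegral_ae_eq (measurable_eval_of_uncurry hWm) hX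
    (fun u ↦ ((measurable_eval_of_uncurry (measurable_increment hWm s) u).const_mul _).sub
      (measurable_timeIntegral (measurable_increment hWm s) s u)) ?_ ?_
  · filter_upwards [ae_continuous_increment hc s] with ω hω
    exact (((NNReal.continuous_coe.sub continuous_const).mul ((hω.pow 2).div_const 2)).add
      ((continuous_timeIntegral (X := fun v ω ↦ increment W s v ω ^ 2) (hω.pow 2)).div_const
        2)).sub ((continuous_timeIntegral hω).mul hω)
  · filter_upwards [ae_continuous_increment hc s] with ω hω u n τ h
    have h1 := h.tendsto_trapezoid_mul_self hω
    have h2 := h.tendsto_trapezoid_of_integrand hω hω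
      (F := fun u ↦ timeIntegral (increment W s) s u ω)
      (fun a b ↦ timeIntegral_sub_timeIntegral hω s a b)
    simp only [trapezoid_increment _ W s ω, trapezoid_sub_left]
    convert h1.sub h2 using 2
    simp only [timeIntegral, pow_two, intervalIntegral.integral_div, increment, sub_self, mul_zero]
    ring

/-- The space-space-time Lévy area in terms of Riemann integrals of the path. -/
theorem spaceSpaceTimeLevyArea_ae_eq (hWm : Measurable (Function.uncurry W))
    (hc : ∀ᵐ ω ∂P, Continuous (W · ω)) {t : ℝ≥0} (hst : s ≤ t) :
    spaceSpaceTimeLevyArea P W s t =ᵐ[P] fun ω ↦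
      1 / 2 * timeIntegral (fun v ω ↦ increment W s v ω ^ 2) s t ω
        - 1 / 2 * (timeIntegral (increment W s) s t ω * increment W s t ω)
        + 1 / 12 * (((t : ℝ) - s) * increment W s t ω ^ 2) := by
  have h1 := stratonovichIntegral_one (P := P) (s := s) hWm hc
  have h2 := stratonovichIntegral_increment hWm hc h1
  have h3 := stratonovichIntegral_timeIntegral_increment (s := s) hWm hc
    (X := timeIntegral (stratonovichIntegral P W (fun _ _ ↦ 1) s) s)
    (by filter_upwards [h1] with ω hω u hu using timeIntegral_congr hu hω)
  have h4 := stratonovichIntegral_time (s := s) hWm hc (X := timeIntegral (fun _ _ ↦ 1) s)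
    (.of_forall fun ω u hu ↦ by simp [timeIntegral])
  have h5 := stratonovichIntegral_time_time hWm hc h4
  filter_upwards [h2, h3, h5] with ω e2 e3 e5
  have e2' := timeIntegral_congr (Y := fun v ω ↦ increment W s v ω ^ 2 / 2) hst e2
  have e2'' : timeIntegral (fun v ω ↦ increment W s v ω ^ 2 / 2) s t ω =
      timeIntegral (fun v ω ↦ increment W s v ω ^ 2) s t ω / 2 := by
    simp only [timeIntegral, intervalIntegral.integral_div]
  simp only [spaceSpaceTimeLevyArea]
  -- With `w`, `A`, `S` the increment and the integrals of the path and of its square, the bracket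
  -- is `S/2 - 2(Aw - S) + (h w²/2 + S/2 - Aw)`.
  rw [e2', e2'', e3 t hst, e5 t hst]
  ring

end Representation

end

/-! ### Limits and moments of Gaussian variables -/

section

variable {Ω : Type*} [MeasurableSpace Ω] {P : Measure Ω}

lemma charFun_map_real {X : Ω → ℝ} (hX : AEMeasurable X P) (t : ℝ) :
    charFun (P.map X) t = ∫ ω, Complex.exp (t * X ω * Complex.I) ∂P := by
  rw [charFun_apply_real, integral_map hX (by fun_prop)]

lemma norm_exp_mul_I (t x : ℝ) : ‖Complex.exp (t * x * Complex.I)‖ = 1 := by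
  rw [← Complex.ofReal_mul, Complex.norm_exp_ofReal_mul_I]

variable [IsProbabilityMeasure P]

/-- An almost sure limit of centered real Gaussian variables is centered Gaussian. -/
lemma exists_map_eq_gaussianReal_of_tendsto {X : ℕ → Ω → ℝ} {Y : Ω → ℝ} {v : ℕ → ℝ≥0}
    (hX : ∀ n, AEMeasurable (X n) P) (hlaw : ∀ n, P.map (X n) = gaussianReal 0 (v n))
    (hlim : ∀ᵐ ω ∂P, Tendsto (fun n ↦ X n ω) atTop (𝓝 (Y ω))) :
    ∃ w : ℝ≥0, P.map Y = gaussianReal 0 w := by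
  have hY : AEMeasurable Y P := aemeasurable_of_tendsto_metrizable_ae _ hX hlim
  have : IsProbabilityMeasure (P.map Y) := Measure.isProbabilityMeasure_map hY
  have hφ (t : ℝ) : Tendsto (fun n ↦ charFun (P.map (X n)) t) atTop (𝓝 (charFun (P.map Y) t)) := by
    simp_rw [charFun_map_real (hX _), charFun_map_real hY]
    refine tendsto_integral_of_dominated_convergence (fun _ ↦ 1)
      (fun n ↦ ?_) (integrable_const 1) (fun n ↦ .of_forall fun ω ↦ (norm_exp_mul_I _ _).le) ?_
    · have := hX n
      exact AEMeasurable.aestronglyMeasurable (by fun_prop)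
    · filter_upwards [hlim] with ω hω
      exact ((Complex.continuous_exp.comp (by fun_prop :
        Continuous fun x : ℝ ↦ (t : ℂ) * x * Complex.I)).tendsto _).comp hω
  -- Written as the power `exp(-v/2) ^ (t²)`, the characteristic function is determined by its value
  -- at `1`; convergence of the variances need not be shown first.
  have hval (n : ℕ) (t : ℝ) :
      charFun (P.map (X n)) t = ((Real.exp (-(v n : ℝ) / 2) ^ (t ^ 2) : ℝ) : ℂ) := by
    rw [hlaw, charFun_gaussianReal, ← Real.exp_mul, Complex.ofReal_exp]
    congr 1
    push_cast
    ring
  set c : ℝ := (charFun (P.map Y) 1).re with hc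
  have hcn : Tendsto (fun n ↦ Real.exp (-(v n : ℝ) / 2)) atTop (𝓝 c) := by
    have := (Complex.continuous_re.tendsto _).comp (hφ 1)
    refine this.congr fun n ↦ ?_
    rw [Function.comp_apply, hval, one_pow, Real.rpow_one, Complex.ofReal_re]
  have hc0 : 0 ≤ c := ge_of_tendsto' hcn fun n ↦ (Real.exp_pos _).le
  have hc1 : c ≤ 1 := le_of_tendsto' hcn fun n ↦ by
    rw [Real.exp_le_one_iff]
    have := (v n).coe_nonneg
    linarith
  have hφc (t : ℝ) : charFun (P.map Y) t = ((c ^ (t ^ 2) : ℝ) : ℂ) := by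
    refine tendsto_nhds_unique (hφ t) ?_
    simp_rw [hval]
    exact (Complex.continuous_ofReal.tendsto _).comp
      (hcn.rpow_const (Or.inr (sq_nonneg t)))
  have hcont : Continuous fun t : ℝ ↦ charFun (P.map Y) t := by
    simp_rw [charFun_map_real hY]
    refine continuous_of_dominated (bound := fun _ ↦ 1) (fun t ↦ ?_)
      (fun t ↦ .of_forall fun ω ↦ (norm_exp_mul_I _ _).le) (integrable_const 1)
      (.of_forall fun ω ↦ by fun_prop)
    exact AEMeasurable.aestronglyMeasurable (by fun_prop)
  -- If `c = 0` (variances escaping to infinity), the limit would vanish off `0`, contradicting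
  -- continuity and the value `1` at `0`.
  have hcpos : 0 < c := by
    refine hc0.lt_of_ne' fun h0 ↦ ?_
    have h1 : Tendsto (fun n : ℕ ↦ charFun (P.map Y) (1 / ((n : ℝ) + 1))) atTop
        (𝓝 (charFun (P.map Y) 0)) :=
      (hcont.tendsto 0).comp tendsto_one_div_add_atTop_nhds_zero_nat
    have h2 : ∀ n : ℕ, charFun (P.map Y) (1 / ((n : ℝ) + 1)) = 0 := fun n ↦ by
      have : (1 / ((n : ℝ) + 1)) ^ 2 ≠ 0 := by positivity
      rw [hφc, h0, Real.zero_rpow this, Complex.ofReal_zero]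
    simp_rw [h2] at h1
    have := tendsto_nhds_unique h1 tendsto_const_nhds
    simp at this
  have hlog : 0 ≤ -2 * Real.log c := by
    have := Real.log_nonpos hc0 hc1
    linarith
  obtain ⟨w, hw⟩ : ∃ w : ℝ≥0, (w : ℝ) = -2 * Real.log c := ⟨⟨_, hlog⟩, rfl⟩
  refine ⟨w, Measure.ext_of_charFun ?_⟩
  ext t
  rw [hφc, charFun_gaussianReal, Real.rpow_def_of_pos hcpos, Complex.ofReal_exp]
  rw [show Real.log c = -(w : ℝ) / 2 by rw [hw]; ring]
  congr 1
  push_cast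
  ring

/-- An almost sure limit of centered Gaussian vectors is Gaussian. -/
lemma hasGaussianLaw_of_tendsto {E : Type*} [NormedAddCommGroup E] [NormedSpace ℝ E]
    [MeasurableSpace E] [BorelSpace E] [SecondCountableTopology E]
    {X : ℕ → Ω → E} {Y : Ω → E} (hX : ∀ n, HasGaussianLaw (X n) P)
    (hmean : ∀ n (L : StrongDual ℝ E), ∫ ω, L (X n ω) ∂P = 0)
    (hlim : ∀ᵐ ω ∂P, Tendsto (fun n ↦ X n ω) atTop (𝓝 (Y ω))) : HasGaussianLaw Y P where
  isGaussian_map := by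
    have hY : AEMeasurable Y P :=
      aemeasurable_of_tendsto_metrizable_ae _ (fun n ↦ (hX n).aemeasurable) hlim
    refine isGaussian_of_map_eq_gaussianReal fun L ↦ ?_
    obtain ⟨w, hw⟩ := exists_map_eq_gaussianReal_of_tendsto (P := P) (X := fun n ω ↦ L (X n ω))
      (Y := fun ω ↦ L (Y ω)) (v := fun n ↦ Var[fun ω ↦ L (X n ω); P].toNNReal)
      (fun n ↦ ((hX n).map_fun L).aemeasurable)
      (fun n ↦ by rw [((hX n).map_fun L).map_eq_gaussianReal, hmean n L])
      (by filter_upwards [hlim] with ω hω using (L.continuous.tendsto _).comp hω)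
    refine ⟨0, w, ?_⟩
    rw [AEMeasurable.map_map_of_aemeasurable (by fun_prop) hY]
    exact hw

section Moments

/-- Differentiation preserves the form polynomial times `exp(v t²/2)`, which makes the successive
derivatives of the Gaussian moment generating function explicit. -/
lemma hasDerivAt_poly_mul_exp {p : ℝ → ℝ} {p' : ℝ} (v t : ℝ) (hp : HasDerivAt p p' t) :
    HasDerivAt (fun t ↦ p t * Real.exp (v * t ^ 2 / 2))
      ((p' + v * t * p t) * Real.exp (v * t ^ 2 / 2)) t := by
  have h : HasDerivAt (fun t : ℝ ↦ v * t ^ 2 / 2) (v * t) t := by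
    refine (((hasDerivAt_pow 2 t).const_mul v).div_const 2).congr_deriv ?_
    simp only [Nat.cast_ofNat, Nat.add_one_sub_one, pow_one]
    ring
  refine (hp.fun_mul h.exp).congr_deriv ?_
  ring

variable {X Y : Ω → ℝ}

/-- The moments are the derivatives at `0` of `exp(v t²/2)`; a vanishing variance is allowed. -/
lemma integral_pow_gaussianLaw (h : HasGaussianLaw X P) (h0 : ∫ ω, X ω ∂P = 0) :
    ∫ ω, X ω ^ 3 ∂P = 0 ∧ ∫ ω, X ω ^ 4 ∂P = 3 * (∫ ω, X ω ^ 2 ∂P) ^ 2 := by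
  have hv : Var[X; P] = ∫ ω, X ω ^ 2 ∂P := variance_of_integral_eq_zero h.aemeasurable h0
  set v := ∫ ω, X ω ^ 2 ∂P with hvdef
  have hv0 : 0 ≤ v := integral_nonneg fun ω ↦ sq_nonneg _
  have hlaw := h.map_eq_gaussianReal
  have hmgf : mgf X P = fun t ↦ Real.exp (v * t ^ 2 / 2) := by
    ext t
    rw [mgf_gaussianReal hlaw, h0, hv, Real.coe_toNNReal _ hv0]
    simp
  have hint : 0 ∈ interior (integrableExpSet X P) := by
    have : integrableExpSet X P = Set.univ :=
      Set.eq_univ_of_forall fun t ↦ mgf_pos_iff.1 (by rw [hmgf]; exact Real.exp_pos _)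
    simp [this]
  have h3 := iteratedDeriv_mgf_zero hint 3
  have h4 := iteratedDeriv_mgf_zero hint 4
  have d1 : deriv (fun t ↦ Real.exp (v * t ^ 2 / 2)) =
      fun t ↦ (v * t) * Real.exp (v * t ^ 2 / 2) := by
    ext t
    have := (hasDerivAt_poly_mul_exp v t (hasDerivAt_const t 1)).deriv
    simpa using this
  have d2 : deriv (fun t ↦ (v * t) * Real.exp (v * t ^ 2 / 2)) =
      fun t ↦ (v + v ^ 2 * t ^ 2) * Real.exp (v * t ^ 2 / 2) := by
    ext t
    rw [(hasDerivAt_poly_mul_exp v t ((hasDerivAt_id' t).const_mul v)).deriv]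
    ring
  have d3 : deriv (fun t ↦ (v + v ^ 2 * t ^ 2) * Real.exp (v * t ^ 2 / 2)) =
      fun t ↦ (3 * v ^ 2 * t + v ^ 3 * t ^ 3) * Real.exp (v * t ^ 2 / 2) := by
    ext t
    rw [(hasDerivAt_poly_mul_exp v t
      (((hasDerivAt_pow 2 t).const_mul (v ^ 2)).const_add v)).deriv]
    simp
    ring
  have d4 : deriv (fun t ↦ (3 * v ^ 2 * t + v ^ 3 * t ^ 3) * Real.exp (v * t ^ 2 / 2)) =
      fun t ↦ (3 * v ^ 2 + 6 * v ^ 3 * t ^ 2 + v ^ 4 * t ^ 4) * Real.exp (v * t ^ 2 / 2) := by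
    ext t
    rw [(hasDerivAt_poly_mul_exp v t
      (((hasDerivAt_id' t).const_mul (3 * v ^ 2)).fun_add
        ((hasDerivAt_pow 3 t).const_mul (v ^ 3)))).deriv]
    simp
    ring
  rw [hmgf] at h3 h4
  simp only [iteratedDeriv_succ, iteratedDeriv_zero, d1, d2, d3, d4] at h3 h4
  simp only [Pi.pow_apply] at h3 h4
  constructor
  · rw [← h3]; simp
  · rw [← h4]; simp

lemma _root_.ProbabilityTheory.HasGaussianLaw.integrable_pow (h : HasGaussianLaw X P) (n : ℕ) :
    Integrable (fun ω ↦ X ω ^ n) P := by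
  have := (h.memLp (p := n) (by simp)).integrable_norm_pow'
  refine this.mono' (h.aemeasurable.pow_const n).aestronglyMeasurable (.of_forall fun ω ↦ ?_)
  simp

lemma _root_.ProbabilityTheory.HasGaussianLaw.memLp_sq (h : HasGaussianLaw X P) :
    MemLp (fun ω ↦ X ω ^ 2) 2 P := by
  rw [memLp_two_iff_integrable_sq (h.aemeasurable.pow_const 2).aestronglyMeasurable]
  simpa only [← pow_mul] using h.integrable_pow 4

/-- Wick's formula for the mixed moments of order three and four of a centered Gaussian pair. -/
lemma integral_mul_sq_gaussianLaw (h : HasGaussianLaw (fun ω ↦ (X ω, Y ω)) P)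
    (hX0 : ∫ ω, X ω ∂P = 0) (hY0 : ∫ ω, Y ω ∂P = 0) :
    ∫ ω, X ω * Y ω ^ 2 ∂P = 0 ∧
    ∫ ω, X ω ^ 2 * Y ω ^ 2 ∂P = (∫ ω, X ω ^ 2 ∂P) * (∫ ω, Y ω ^ 2 ∂P)
      + 2 * (∫ ω, X ω * Y ω ∂P) ^ 2 := by
  have hX := h.fst
  have hY := h.snd
  -- Polarization: `X ± Y` are again centered Gaussian, and both mixed monomials are combinations of
  -- pure powers of `X`, `Y` and `X ± Y`.
  have hp := h.fun_add
  have hm := h.fun_sub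
  have iXY : Integrable (fun ω ↦ X ω * Y ω) P := hX.memLp_two.integrable_mul hY.memLp_two
  have hp0 : ∫ ω, X ω + Y ω ∂P = 0 := by
    rw [integral_add hX.integrable hY.integrable, hX0, hY0, add_zero]
  have hm0 : ∫ ω, X ω - Y ω ∂P = 0 := by
    rw [integral_sub hX.integrable hY.integrable, hX0, hY0, sub_zero]
  obtain ⟨p3, p4⟩ := integral_pow_gaussianLaw hp hp0
  obtain ⟨m3, m4⟩ := integral_pow_gaussianLaw hm hm0
  obtain ⟨x3, x4⟩ := integral_pow_gaussianLaw hX hX0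
  obtain ⟨-, y4⟩ := integral_pow_gaussianLaw hY hY0
  have e2p : ∫ ω, (X ω + Y ω) ^ 2 ∂P =
      ∫ ω, X ω ^ 2 ∂P + 2 * ∫ ω, X ω * Y ω ∂P + ∫ ω, Y ω ^ 2 ∂P := by
    rw [← integral_const_mul, ← integral_add (hX.integrable_pow 2) (iXY.const_mul 2),
      ← integral_add ((hX.integrable_pow 2).fun_add (iXY.const_mul 2)) (hY.integrable_pow 2)]
    congr with ω
    ring
  have e2m : ∫ ω, (X ω - Y ω) ^ 2 ∂P =
      ∫ ω, X ω ^ 2 ∂P - 2 * ∫ ω, X ω * Y ω ∂P + ∫ ω, Y ω ^ 2 ∂P := by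
    have hi : Integrable (fun ω ↦ X ω ^ 2 - 2 * (X ω * Y ω)) P :=
      (hX.integrable_pow 2).sub (iXY.const_mul 2)
    rw [← integral_const_mul, ← integral_sub (hX.integrable_pow 2) (iXY.const_mul 2),
      ← integral_add hi (hY.integrable_pow 2)]
    congr with ω
    ring
  constructor
  · have : ∀ ω, X ω * Y ω ^ 2 =
        1 / 6 * ((X ω + Y ω) ^ 3 + (X ω - Y ω) ^ 3) - 1 / 3 * X ω ^ 3 := fun ω ↦ by ring
    simp_rw [this]
    rw [integral_sub (((hp.integrable_pow 3).fun_add (hm.integrable_pow 3)).const_mul _)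
      ((hX.integrable_pow 3).const_mul _), integral_const_mul, integral_const_mul,
      integral_add (hp.integrable_pow 3) (hm.integrable_pow 3), p3, m3, x3]
    ring
  · have : ∀ ω, X ω ^ 2 * Y ω ^ 2 =
        1 / 12 * ((X ω + Y ω) ^ 4 + (X ω - Y ω) ^ 4) - 1 / 6 * (X ω ^ 4 + Y ω ^ 4) :=
      fun ω ↦ by ring
    simp_rw [this]
    rw [integral_sub (((hp.integrable_pow 4).fun_add (hm.integrable_pow 4)).const_mul _)
      (((hX.integrable_pow 4).fun_add (hY.integrable_pow 4)).const_mul _), integral_const_mul,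
      integral_const_mul, integral_add (hp.integrable_pow 4) (hm.integrable_pow 4),
      integral_add (hX.integrable_pow 4) (hY.integrable_pow 4), p4, m4, x4, y4, e2p, e2m]
    ring

end Moments

end

/-! ### Fubini for time integrals; joint Gaussianity of the path and its integral -/

section

lemma timeIntegral_zero_one {Ω : Type*} (X : ℝ≥0 → Ω → ℝ) (ω : Ω) :
    timeIntegral X 0 1 ω = ∫ v in (0 : ℝ)..1, X v.toNNReal ω := by
  simp [timeIntegral]

lemma integral_prod_eq {Ω : Type*} (X Y : ℝ → Ω → ℝ) (ω : Ω) :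
    ∫ p : ℝ × ℝ, X p.1 ω * Y p.2 ω ∂((volume.restrict (Set.Ioc (0 : ℝ) 1)).prod
      (volume.restrict (Set.Ioc (0 : ℝ) 1))) =
      (∫ u in (0 : ℝ)..1, X u ω) * ∫ u in (0 : ℝ)..1, Y u ω := by
  rw [intervalIntegral.integral_of_le zero_le_one, intervalIntegral.integral_of_le zero_le_one,
    integral_prod_mul (fun u ↦ X u ω) (fun u ↦ Y u ω)]

variable {Ω : Type*} [MeasurableSpace Ω] {P : Measure Ω}

/-- A measurable process on `(0, 1]` which is bounded in `L²`. -/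
structure IsL2Process (X : ℝ → Ω → ℝ) (P : Measure Ω) : Prop where
  measurable : Measurable (Function.uncurry X)
  memLp : ∀ u ∈ Set.Ioc (0 : ℝ) 1, MemLp (X u) 2 P
  bounded : ∃ C, ∀ u ∈ Set.Ioc (0 : ℝ) 1, ∫ ω, X u ω ^ 2 ∂P ≤ C

namespace IsL2Process

variable {X Y : ℝ → Ω → ℝ}

/-- Lets a fixed random variable enter Fubini's theorem for two time integrals, which then also
covers `E[X ∫ Y]` and, with `X = 1`, `E[∫ Y]`. -/
lemma const {X : Ω → ℝ} (hX : Measurable X) (h : MemLp X 2 P) :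
    IsL2Process (fun _ ↦ X) P :=
  ⟨hX.comp measurable_snd, fun _ _ ↦ h, _, fun _ _ ↦ le_rfl⟩

lemma measurable_integral (hX : IsL2Process X P) :
    Measurable fun ω ↦ ∫ u in (0 : ℝ)..1, X u ω := by
  simp_rw [intervalIntegral.integral_of_le (zero_le_one' ℝ)]
  exact (hX.measurable.stronglyMeasurable.integral_prod_left
    (μ := volume.restrict (Set.Ioc (0 : ℝ) 1))).measurable

variable [IsProbabilityMeasure P]

/-- `|XY| ≤ (X² + Y²)/2` and the uniform second moment bounds control the inner integral on the unit
square, which has finite measure. -/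
lemma integrable_mul_prod (hX : IsL2Process X P) (hY : IsL2Process Y P) :
    Integrable (fun p : (ℝ × ℝ) × Ω ↦ X p.1.1 p.2 * Y p.1.2 p.2)
      (((volume.restrict (Set.Ioc (0 : ℝ) 1)).prod (volume.restrict (Set.Ioc (0 : ℝ) 1))).prod
        P) := by
  obtain ⟨C, hC⟩ := hX.bounded
  obtain ⟨D, hD⟩ := hY.bounded
  have hXm : Measurable fun p : (ℝ × ℝ) × Ω ↦ X p.1.1 p.2 :=
    hX.measurable.comp (by fun_prop : Measurable fun p : (ℝ × ℝ) × Ω ↦ (p.1.1, p.2))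
  have hYm : Measurable fun p : (ℝ × ℝ) × Ω ↦ Y p.1.2 p.2 :=
    hY.measurable.comp (by fun_prop : Measurable fun p : (ℝ × ℝ) × Ω ↦ (p.1.2, p.2))
  have hm : StronglyMeasurable fun p : (ℝ × ℝ) × Ω ↦ X p.1.1 p.2 * Y p.1.2 p.2 :=
    (hXm.mul hYm).stronglyMeasurable
  have hmem : ∀ᵐ p : ℝ × ℝ ∂(volume.restrict (Set.Ioc (0 : ℝ) 1)).prod
      (volume.restrict (Set.Ioc (0 : ℝ) 1)), p.1 ∈ Set.Ioc (0 : ℝ) 1 ∧ p.2 ∈ Set.Ioc (0 : ℝ) 1 := by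
    rw [Measure.prod_restrict]
    exact ae_restrict_of_forall_mem (measurableSet_Ioc.prod measurableSet_Ioc) fun p hp ↦ hp
  rw [integrable_prod_iff hm.aestronglyMeasurable]
  constructor
  · filter_upwards [hmem] with p hp
    exact (hX.memLp _ hp.1).integrable_mul (hY.memLp _ hp.2)
  · refine Integrable.mono' (integrable_const ((C + D) / 2))
      (hm.norm.integral_prod_right.aestronglyMeasurable) ?_
    filter_upwards [hmem] with p hp
    have iX := (hX.memLp _ hp.1).integrable_sq
    have iY := (hY.memLp _ hp.2).integrable_sq
    rw [Real.norm_of_nonneg (integral_nonneg fun ω ↦ norm_nonneg _)]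
    calc ∫ ω, ‖X p.1 ω * Y p.2 ω‖ ∂P
        ≤ ∫ ω, (X p.1 ω ^ 2 + Y p.2 ω ^ 2) / 2 ∂P := by
          refine integral_mono ((hX.memLp _ hp.1).integrable_mul (hY.memLp _ hp.2)).norm
            ((iX.fun_add iY).div_const 2) fun ω ↦ ?_
          dsimp only
          rw [norm_mul, Real.norm_eq_abs, Real.norm_eq_abs, ← sq_abs (X p.1 ω), ← sq_abs (Y p.2 ω)]
          nlinarith [sq_nonneg (|X p.1 ω| - |Y p.2 ω|)]
      _ ≤ (C + D) / 2 := by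
          rw [integral_div, integral_add iX iY]
          linarith [hC _ hp.1, hD _ hp.2]

lemma integrable_integral_mul (hX : IsL2Process X P) (hY : IsL2Process Y P) :
    Integrable (fun ω ↦ (∫ u in (0 : ℝ)..1, X u ω) * ∫ u in (0 : ℝ)..1, Y u ω) P := by
  simpa only [integral_prod_eq] using (hX.integrable_mul_prod hY).integral_prod_right

/-- Fubini's theorem for a product of two time integrals. -/
lemma integral_integral_mul (hX : IsL2Process X P) (hY : IsL2Process Y P) :
    ∫ ω, (∫ u in (0 : ℝ)..1, X u ω) * (∫ u in (0 : ℝ)..1, Y u ω) ∂P =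
      ∫ u in (0 : ℝ)..1, ∫ v in (0 : ℝ)..1, ∫ ω, X u ω * Y v ω ∂P := by
  have h := hX.integrable_mul_prod hY
  simp_rw [← integral_prod_eq]
  rw [← integral_integral_swap (f := fun (p : ℝ × ℝ) ω ↦ X p.1 ω * Y p.2 ω) h,
    integral_prod _ h.integral_prod_left, intervalIntegral.integral_of_le zero_le_one]
  simp_rw [intervalIntegral.integral_of_le (zero_le_one' ℝ)]

lemma memLp_integral (hX : IsL2Process X P) : MemLp (fun ω ↦ ∫ u in (0 : ℝ)..1, X u ω) 2 P := by
  rw [memLp_two_iff_integrable_sq hX.measurable_integral.aestronglyMeasurable]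
  simpa only [pow_two] using hX.integrable_integral_mul hX

lemma integral_integral (hX : IsL2Process X P) :
    ∫ ω, (∫ u in (0 : ℝ)..1, X u ω) ∂P = ∫ u in (0 : ℝ)..1, ∫ ω, X u ω ∂P := by
  simpa using hX.integral_integral_mul (const (X := fun _ ↦ 1) measurable_const (memLp_const 1))

end IsL2Process

section GaussianProcess

variable {S T : Type*}

lemma isGaussianProcess_of_mem_span {X : T → Ω → ℝ} (hX : IsGaussianProcess X P) {Y : S → Ω → ℝ}
    (h : ∀ s, Y s ∈ Submodule.span ℝ (Set.range X)) : IsGaussianProcess Y P := by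
  refine hX.of_isGaussianProcess fun s ↦ ?_
  obtain ⟨c, hc⟩ := Finsupp.mem_span_range_iff_exists_finsupp.1 (h s)
  refine ⟨c.support, ∑ i : c.support, c i • ContinuousLinearMap.proj i, fun ω ↦ ?_⟩
  rw [← hc, Finsupp.sum, Finset.sum_apply, ← Finset.sum_coe_sort]
  simp

/-- Only finite families of indices matter, so convergence index by index gives almost sure
convergence of the vectors. -/
lemma isGaussianProcess_of_tendsto [IsProbabilityMeasure P] {X : ℕ → T → Ω → ℝ} {Y : T → Ω → ℝ}
    (hX : ∀ n, IsGaussianProcess (X n) P) (hmean : ∀ n t, ∫ ω, X n t ω ∂P = 0)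
    (hlim : ∀ t, ∀ᵐ ω ∂P, Tendsto (fun n ↦ X n t ω) atTop (𝓝 (Y t ω))) :
    IsGaussianProcess Y P where
  hasGaussianLaw I := by
    refine hasGaussianLaw_of_tendsto (fun n ↦ (hX n).hasGaussianLaw I) (fun n L ↦ ?_) ?_
    · have hi := ((hX n).hasGaussianLaw I).integrable
      rw [L.integral_comp_comm hi]
      convert L.map_zero
      ext i
      exact (eval_integral (f := fun ω (i : I) ↦ X n i ω)
        (fun i : I ↦ ((hX n).hasGaussianLaw_eval i).integrable) i).trans (hmean n i)
    · have : ∀ᵐ ω ∂P, ∀ i : I, Tendsto (fun n ↦ X n i ω) atTop (𝓝 (Y i ω)) :=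
        ae_all_iff.2 fun i ↦ hlim i
      filter_upwards [this] with ω hω
      exact tendsto_pi_nhds.2 hω

end GaussianProcess

section BrownianMotion

variable {B : ℝ≥0 → Ω → ℝ}

/-- The Brownian motion together with its time integral over `[0, 1]`. -/
def withIntegral (B : ℝ≥0 → Ω → ℝ) : Option ℝ≥0 → Ω → ℝ
  | none => timeIntegral B 0 1
  | some t => B t

lemma tendsto_trapezoid_timeIntegral {f : ℝ≥0 → ℝ} (hf : Continuous f) :
    Tendsto (fun k ↦ trapezoid f (fun u ↦ (u : ℝ)) (k + 1) (uniformPartition 0 1 k)) atTop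
      (𝓝 (∫ v in (0 : ℝ)..1, f v.toNNReal)) := by
  have := (isPartitionSeq_uniformPartition (zero_le_one' ℝ≥0)).tendsto_trapezoid hf
    (f := fun _ ↦ 1) (F := fun u ↦ (u : ℝ)) continuous_const (by intro a b; simp)
  simpa using this

/-- The time integral is a pathwise limit of trapezoidal sums, which are finite linear combinations
of values of `B`. The extended process is thus a limit of centered Gaussian processes. -/
lemma isGaussianProcess_withIntegral (hB : IsBrownianReal B P) :
    IsGaussianProcess (withIntegral B) P := by
  have hG := hB.isGaussianProcess
  have := hG.isProbabilityMeasure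
  let X : ℕ → Option ℝ≥0 → Ω → ℝ := fun k o ↦ match o with
    | none => fun ω ↦ trapezoid (B · ω) (fun u ↦ (u : ℝ)) (k + 1) (uniformPartition 0 1 k)
    | some t => B t
  refine isGaussianProcess_of_tendsto (X := X) (fun k ↦ ?_) (fun k t ↦ ?_) (fun t ↦ ?_)
  · refine isGaussianProcess_of_mem_span hG fun o ↦ ?_
    have hmem (t : ℝ≥0) : B t ∈ Submodule.span ℝ (Set.range B) := Submodule.subset_span ⟨t, rfl⟩
    match o with
    | some t => exact hmem t
    | none =>
      have e : X k none = ∑ i ∈ Finset.range (k + 1),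
          (((uniformPartition 0 1 k (i + 1) : ℝ) - uniformPartition 0 1 k i) / 2) •
            (B (uniformPartition 0 1 k i) + B (uniformPartition 0 1 k (i + 1))) := by
        ext ω
        simp only [X, trapezoid, Finset.sum_apply, Pi.smul_apply, Pi.add_apply, smul_eq_mul]
        exact Finset.sum_congr rfl fun i _ ↦ by ring
      rw [e]
      exact Submodule.sum_mem _ fun i _ ↦
        Submodule.smul_mem _ _ (Submodule.add_mem _ (hmem _) (hmem _))
  · match t with
    | some t => exact hB.integral_eval t
    | none =>
      simp only [X, trapezoid]
      have hi (t : ℝ≥0) := hB.integrable_eval t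
      rw [integral_finsetSum _ fun i _ ↦
        (((hi _).fun_add (hi _)).div_const 2).mul_const _]
      refine Finset.sum_eq_zero fun i _ ↦ ?_
      rw [integral_mul_const, integral_div, integral_add (hi _) (hi _), hB.integral_eval,
        hB.integral_eval]
      simp
  · match t with
    | some t => exact .of_forall fun ω ↦ tendsto_const_nhds
    | none =>
      filter_upwards [hB.cont] with ω hω
      simp only [withIntegral, timeIntegral_zero_one]
      exact tendsto_trapezoid_timeIntegral hω

end BrownianMotion

end

/-! ### Polynomial integrals of the bridge kernel -/

section

lemma integral_eq_add_of_eqOn {g g₁ g₂ : ℝ → ℝ} {u : ℝ} (hu : u ∈ Set.Icc (0 : ℝ) 1)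
    (h₁ : ∀ v ∈ Set.Icc 0 u, g v = g₁ v) (h₂ : ∀ v ∈ Set.Icc u 1, g v = g₂ v)
    (c₁ : Continuous g₁) (c₂ : Continuous g₂) :
    ∫ v in (0 : ℝ)..1, g v = (∫ v in (0 : ℝ)..u, g₁ v) + ∫ v in u..1, g₂ v := by
  have e₁ : Set.EqOn g g₁ (Set.uIcc 0 u) := by rw [Set.uIcc_of_le hu.1]; exact h₁
  have e₂ : Set.EqOn g g₂ (Set.uIcc u 1) := by rw [Set.uIcc_of_le hu.2]; exact h₂
  rw [← intervalIntegral.integral_congr e₁, ← intervalIntegral.integral_congr e₂,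
    intervalIntegral.integral_add_adjacent_intervals]
  · exact (c₁.intervalIntegrable 0 u).congr fun v hv ↦ (e₁ (Set.uIoc_subset_uIcc hv)).symm
  · exact (c₂.intervalIntegrable u 1).congr fun v hv ↦ (e₂ (Set.uIoc_subset_uIcc hv)).symm

lemma integral_congr_zero_one {f g : ℝ → ℝ} (h : ∀ u ∈ Set.Icc (0 : ℝ) 1, f u = g u) :
    ∫ u in (0 : ℝ)..1, f u = ∫ u in (0 : ℝ)..1, g u :=
  intervalIntegral.integral_congr (by rw [Set.uIcc_of_le zero_le_one]; exact h)

lemma integral_sum_pow (n : ℕ) (c : ℕ → ℝ) (a b : ℝ) :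
    ∫ v in a..b, ∑ i ∈ Finset.range n, c i * v ^ i =
      ∑ i ∈ Finset.range n, c i * ((b ^ (i + 1) - a ^ (i + 1)) / (i + 1)) := by
  rw [intervalIntegral.integral_finsetSum fun i _ ↦
    (by fun_prop : Continuous fun v : ℝ ↦ c i * v ^ i).intervalIntegrable _ _]
  simp

/-- The integral of a polynomial of degree at most six. -/
lemma integral_eq_of_forall_eq_poly {f : ℝ → ℝ} {a b : ℝ} (c₀ c₁ c₂ c₃ c₄ c₅ c₆ : ℝ)
    (h : ∀ v, f v = c₀ + c₁ * v + c₂ * v ^ 2 + c₃ * v ^ 3 + c₄ * v ^ 4 + c₅ * v ^ 5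
      + c₆ * v ^ 6) :
    ∫ v in a..b, f v =
      c₀ * (b - a) + c₁ * ((b ^ 2 - a ^ 2) / 2) + c₂ * ((b ^ 3 - a ^ 3) / 3)
        + c₃ * ((b ^ 4 - a ^ 4) / 4) + c₄ * ((b ^ 5 - a ^ 5) / 5) + c₅ * ((b ^ 6 - a ^ 6) / 6)
        + c₆ * ((b ^ 7 - a ^ 7) / 7) := by
  have := integral_sum_pow 7 (fun i ↦ [c₀, c₁, c₂, c₃, c₄, c₅, c₆].getD i 0) a b
  norm_num [Finset.sum_range_succ] at this
  simp_rw [h]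
  convert this using 3

lemma integral_min {u : ℝ} (hu : u ∈ Set.Icc (0 : ℝ) 1) :
    ∫ v in (0 : ℝ)..1, min u v = u - u ^ 2 / 2 := by
  rw [integral_eq_add_of_eqOn (g₁ := fun v ↦ v) (g₂ := fun _ ↦ u) hu
    (fun v hv ↦ min_eq_right hv.2) (fun v hv ↦ min_eq_left hv.1) continuous_id continuous_const]
  simp
  ring

/-- The covariance function of the Brownian motion on `[0, 1]` conditioned on `W_1 = 0` and
`∫_0^1 W_u du = 0`. -/
def bridgeKernel (u v : ℝ) : ℝ := min u v - u * v - 3 * (u * (1 - u)) * (v * (1 - v))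

/-- The kernel is polynomial on either side of the diagonal; `φ` accommodates both weights and
powers. -/
lemma integral_bridgeKernel_aux {φ : ℝ → ℝ → ℝ} (hφ : Continuous (Function.uncurry φ)) {u : ℝ}
    (hu : u ∈ Set.Icc (0 : ℝ) 1) :
    ∫ v in (0 : ℝ)..1, φ v (bridgeKernel u v) =
      (∫ v in (0 : ℝ)..u, φ v (v - u * v - 3 * (u * (1 - u)) * (v * (1 - v)))) +
        ∫ v in u..1, φ v (u - u * v - 3 * (u * (1 - u)) * (v * (1 - v))) :=
  integral_eq_add_of_eqOn hu (fun v hv ↦ by rw [bridgeKernel, min_eq_right hv.2])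
    (fun v hv ↦ by rw [bridgeKernel, min_eq_left hv.1])
    (hφ.comp (by fun_prop : Continuous fun v ↦
      (v, v - u * v - 3 * (u * (1 - u)) * (v * (1 - v)))))
    (hφ.comp (by fun_prop : Continuous fun v ↦
      (v, u - u * v - 3 * (u * (1 - u)) * (v * (1 - v)))))

lemma integral_id_mul_bridgeKernel {u : ℝ} (hu : u ∈ Set.Icc (0 : ℝ) 1) :
    ∫ v in (0 : ℝ)..1, v * bridgeKernel u v = -1 / 12 * u + 1 / 4 * u ^ 2 - 1 / 6 * u ^ 3 := by
  rw [integral_bridgeKernel_aux (φ := fun v x ↦ v * x) (by fun_prop) hu,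
    integral_eq_of_forall_eq_poly 0 0 (1 - 4 * u + 3 * u ^ 2) (3 * u - 3 * u ^ 2) 0 0 0
      fun v ↦ by ring,
    integral_eq_of_forall_eq_poly 0 u (-4 * u + 3 * u ^ 2) (3 * u - 3 * u ^ 2) 0 0 0
      fun v ↦ by ring]
  ring

lemma integral_quad_mul_bridgeKernel {u : ℝ} (hu : u ∈ Set.Icc (0 : ℝ) 1) :
    ∫ v in (0 : ℝ)..1, 6 * (v * (1 - v)) * bridgeKernel u v =
      -1 / 10 * u + 3 / 5 * u ^ 2 - u ^ 3 + 1 / 2 * u ^ 4 := by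
  rw [integral_bridgeKernel_aux (φ := fun v x ↦ 6 * (v * (1 - v)) * x) (by fun_prop) hu,
    integral_eq_of_forall_eq_poly 0 0 (6 - 24 * u + 18 * u ^ 2) (-6 + 42 * u - 36 * u ^ 2)
      (-18 * u + 18 * u ^ 2) 0 0 fun v ↦ by ring,
    integral_eq_of_forall_eq_poly 0 (6 * u) (-30 * u + 18 * u ^ 2) (42 * u - 36 * u ^ 2)
      (-18 * u + 18 * u ^ 2) 0 0 fun v ↦ by ring]
  ring

lemma integral_bridgeKernel_sq {u : ℝ} (hu : u ∈ Set.Icc (0 : ℝ) 1) :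
    ∫ v in (0 : ℝ)..1, bridgeKernel u v ^ 2 =
      2 / 15 * u ^ 2 - 23 / 30 * u ^ 3 + 49 / 30 * u ^ 4 - 3 / 2 * u ^ 5 + 1 / 2 * u ^ 6 := by
  rw [integral_bridgeKernel_aux (φ := fun v x ↦ x ^ 2) (by fun_prop) hu,
    integral_eq_of_forall_eq_poly 0 0 (1 - 8 * u + 22 * u ^ 2 - 24 * u ^ 3 + 9 * u ^ 4)
      (6 * u - 30 * u ^ 2 + 42 * u ^ 3 - 18 * u ^ 4) (9 * u ^ 2 - 18 * u ^ 3 + 9 * u ^ 4) 0 0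
      fun v ↦ by ring,
    integral_eq_of_forall_eq_poly (u ^ 2) (-8 * u ^ 2 + 6 * u ^ 3)
      (22 * u ^ 2 - 30 * u ^ 3 + 9 * u ^ 4) (-24 * u ^ 2 + 42 * u ^ 3 - 18 * u ^ 4)
      (9 * u ^ 2 - 18 * u ^ 3 + 9 * u ^ 4) 0 0 fun v ↦ by ring]
  ring

lemma integral_integral_id_id :
    ∫ u in (0 : ℝ)..1, ∫ v in (0 : ℝ)..1, u * v * bridgeKernel u v = 1 / 720 := by
  simp_rw [mul_assoc, intervalIntegral.integral_const_mul]
  rw [integral_congr_zero_one fun u hu ↦ by rw [integral_id_mul_bridgeKernel hu],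
    integral_eq_of_forall_eq_poly 0 0 (-1 / 12) (1 / 4) (-1 / 6) 0 0 fun v ↦ by ring]
  norm_num

/-- The value reflects the invariance of the kernel under `(u, v) ↦ (1 - u, 1 - v)` and its zero
integral in `u`: replacing `u` by the odd weight `u - 1/2` changes nothing, while `v(1 - v)` is
even. Here it is integrated directly. -/
lemma integral_integral_id_quad :
    ∫ u in (0 : ℝ)..1, ∫ v in (0 : ℝ)..1, u * (6 * (v * (1 - v))) * bridgeKernel u v = 0 := by
  simp_rw [mul_assoc _ (6 * _) (bridgeKernel _ _), intervalIntegral.integral_const_mul]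
  rw [integral_congr_zero_one fun u hu ↦ by rw [integral_quad_mul_bridgeKernel hu],
    integral_eq_of_forall_eq_poly 0 0 (-1 / 10) (3 / 5) (-1) (1 / 2) 0 fun v ↦ by ring]
  norm_num

lemma integral_integral_quad_quad :
    ∫ u in (0 : ℝ)..1, ∫ v in (0 : ℝ)..1,
      6 * (u * (1 - u)) * (6 * (v * (1 - v))) * bridgeKernel u v = 1 / 700 := by
  simp_rw [mul_assoc _ (6 * (_ * _)) (bridgeKernel _ _), intervalIntegral.integral_const_mul]
  rw [integral_congr_zero_one fun u hu ↦ by rw [integral_quad_mul_bridgeKernel hu],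
    integral_eq_of_forall_eq_poly 0 0 (-3 / 5) (21 / 5) (-48 / 5) 9 (-3) fun v ↦ by ring]
  norm_num

lemma integral_bridgeKernel_self : ∫ u in (0 : ℝ)..1, bridgeKernel u u = 1 / 15 := by
  rw [integral_eq_of_forall_eq_poly 0 1 (-4) 6 (-3) 0 0
    fun v ↦ by rw [bridgeKernel, min_self]; ring]
  norm_num

lemma continuous_bridgeKernel : Continuous (Function.uncurry bridgeKernel) := by
  unfold bridgeKernel Function.uncurry
  fun_prop

/-- The product of diagonals contributes `(1/15)² = 1/225`, the squared kernel the rest. -/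
lemma integral_integral_wick :
    ∫ u in (0 : ℝ)..1, ∫ v in (0 : ℝ)..1,
      (bridgeKernel u u * bridgeKernel v v + 2 * bridgeKernel u v ^ 2) =
      1 / 225 + 11 / 6300 := by
  have hd : Continuous fun v ↦ bridgeKernel v v :=
    continuous_bridgeKernel.comp (continuous_id.prodMk continuous_id)
  have hs (u : ℝ) : Continuous fun v ↦ bridgeKernel u v :=
    continuous_bridgeKernel.comp (continuous_const.prodMk continuous_id)
  have hs2 (u : ℝ) : Continuous fun v ↦ 2 * bridgeKernel u v ^ 2 := ((hs u).pow 2).const_mul 2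
  have e : ∀ u ∈ Set.Icc (0 : ℝ) 1,
      ∫ v in (0 : ℝ)..1, (bridgeKernel u u * bridgeKernel v v + 2 * bridgeKernel u v ^ 2) =
      bridgeKernel u u * (1 / 15) + 2 * (2 / 15 * u ^ 2 - 23 / 30 * u ^ 3 + 49 / 30 * u ^ 4
        - 3 / 2 * u ^ 5 + 1 / 2 * u ^ 6) := fun u hu ↦ by
    rw [intervalIntegral.integral_add ((hd.const_mul _).intervalIntegrable _ _)
      ((hs2 u).intervalIntegrable _ _), intervalIntegral.integral_const_mul,
      intervalIntegral.integral_const_mul, integral_bridgeKernel_self, integral_bridgeKernel_sq hu]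
  rw [integral_congr_zero_one e, intervalIntegral.integral_add
    ((hd.mul_const _).intervalIntegrable _ _)
    ((by fun_prop : Continuous fun u : ℝ ↦ 2 * (2 / 15 * u ^ 2 - 23 / 30 * u ^ 3
      + 49 / 30 * u ^ 4 - 3 / 2 * u ^ 5 + 1 / 2 * u ^ 6)).intervalIntegrable _ _),
    intervalIntegral.integral_mul_const, integral_bridgeKernel_self,
    integral_eq_of_forall_eq_poly 0 0 (4 / 15) (-23 / 15) (49 / 15) (-3) 1 fun v ↦ by ring]
  norm_num

end

/-! ### Conditional moments of sums of products -/

section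

section CondVar

variable {Ω : Type*} {m₁ m₂ m₀ : MeasurableSpace Ω} {P : Measure Ω} [IsProbabilityMeasure P]

/-- The known factor is pulled out and the independent one is replaced by its mean. Independence
makes the product of two integrable variables integrable. Measurability of `g` up to null sets is
what time integrals of the residual provide. -/
lemma integrable_mul_and_condExp_mul (hm₁ : m₁ ≤ m₀) (hm₂ : m₂ ≤ m₀) (hind : Indep m₁ m₂ P)
    {f g : Ω → ℝ} (hf : StronglyMeasurable[m₂] f) (hfi : Integrable f P)
    (hg : AEStronglyMeasurable[m₁] g P) (hgi : Integrable g P) :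
    Integrable (fun ω ↦ f ω * g ω) P ∧
      P[fun ω ↦ f ω * g ω | m₂] =ᵐ[P] fun ω ↦ f ω * ∫ x, g x ∂P := by
  obtain ⟨g', hg', hgg'⟩ := hg
  have hgi' : Integrable g' P := hgi.congr hgg'
  have hindep : IndepFun f g' P :=
    indep_of_indep_of_le_left (indep_of_indep_of_le_right hind.symm hg'.measurable.comap_le)
      hf.measurable.comap_le
  have hint : Integrable (fun ω ↦ f ω * g ω) P := by
    refine (hindep.integrable_mul hfi hgi').congr ?_
    filter_upwards [hgg'] with ω hω
    rw [Pi.mul_apply, hω]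
  refine ⟨hint, ?_⟩
  have h1 := condExp_mul_of_stronglyMeasurable_left (μ := P) hf hint hgi
  have h2 := (condExp_congr_ae (m := m₂) hgg').trans (condExp_indep_eq hm₁ hm₂ hg' hind)
  filter_upwards [h1, h2] with ω e1 e2
  rw [integral_congr_ae hgg', ← e2]
  exact e1

variable {n : ℕ} {f g : Fin n → Ω → ℝ}

/-- Conditional mean and variance of a sum of products whose first factors are measurable with
respect to, and whose second factors are independent of, the conditioning σ-algebra. -/
theorem condExp_condVar_sum_mul (hm₁ : m₁ ≤ m₀) (hm₂ : m₂ ≤ m₀) (hind : Indep m₁ m₂ P)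
    (hf : ∀ i, StronglyMeasurable[m₂] (f i)) (hfL : ∀ i, MemLp (f i) 2 P)
    (hg : ∀ i, AEStronglyMeasurable[m₁] (g i) P) (hgL : ∀ i, MemLp (g i) 2 P) :
    MemLp (fun ω ↦ ∑ i, f i ω * g i ω) 2 P ∧
    (P[fun ω ↦ ∑ i, f i ω * g i ω | m₂] =ᵐ[P] fun ω ↦ ∑ i, f i ω * ∫ x, g i x ∂P) ∧
    condVar m₂ (fun ω ↦ ∑ i, f i ω * g i ω) P =ᵐ[P] fun ω ↦ ∑ i, ∑ j, f i ω * f j ω *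
      (∫ x, g i x * g j x ∂P - (∫ x, g i x ∂P) * ∫ x, g j x ∂P) := by
  have h1 (i : Fin n) := integrable_mul_and_condExp_mul hm₁ hm₂ hind (hf i)
    ((hfL i).integrable one_le_two) (hg i) ((hgL i).integrable one_le_two)
  -- For the square, the same lemma is applied to `f i * f j` and `g i * g j`, which are merely
  -- integrable; hence second moments of the factors suffice.
  have h2 (i j : Fin n) := integrable_mul_and_condExp_mul hm₁ hm₂ hind ((hf i).mul (hf j))
    ((hfL i).integrable_mul (hfL j)) ((hg i).mul (hg j)) ((hgL i).integrable_mul (hgL j))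
  have hsq : ∀ ω, (∑ i, f i ω * g i ω) ^ 2 = ∑ i, ∑ j, (f i * f j) ω * (g i * g j) ω := fun ω ↦ by
    rw [pow_two, Finset.sum_mul_sum]
    exact Finset.sum_congr rfl fun i _ ↦ Finset.sum_congr rfl fun j _ ↦ by
      simp only [Pi.mul_apply]
      ring
  have hX : MemLp (fun ω ↦ ∑ i, f i ω * g i ω) 2 P := by
    have hmeas : AEStronglyMeasurable (fun ω ↦ ∑ i, f i ω * g i ω) P :=
      (integrable_finsetSum _ fun i _ ↦ (h1 i).1).aestronglyMeasurable
    rw [memLp_two_iff_integrable_sq hmeas]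
    simp_rw [hsq]
    exact integrable_finsetSum _ fun i _ ↦ integrable_finsetSum _ fun j _ ↦ (h2 i j).1
  have hE : P[fun ω ↦ ∑ i, f i ω * g i ω | m₂] =ᵐ[P] fun ω ↦ ∑ i, f i ω * ∫ x, g i x ∂P := by
    have e : (fun ω ↦ ∑ i, f i ω * g i ω) = ∑ i, fun ω ↦ f i ω * g i ω := by
      ext ω
      simp
    have hall : ∀ᵐ ω ∂P, ∀ i, (P[fun ω ↦ f i ω * g i ω | m₂]) ω = f i ω * ∫ x, g i x ∂P :=
      ae_all_iff.2 fun i ↦ (h1 i).2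
    rw [e]
    filter_upwards [condExp_finsetSum (s := Finset.univ) (fun i _ ↦ (h1 i).1) m₂, hall] with ω e1 e2
    rw [e1, Finset.sum_apply]
    exact Finset.sum_congr rfl fun i _ ↦ e2 i
  refine ⟨hX, hE, ?_⟩
  have hE2 : P[(fun ω ↦ ∑ i, f i ω * g i ω) ^ 2 | m₂] =ᵐ[P]
      fun ω ↦ ∑ i, ∑ j, f i ω * f j ω * ∫ x, g i x * g j x ∂P := by
    have e : (fun ω ↦ ∑ i, f i ω * g i ω) ^ 2 =
        ∑ p : Fin n × Fin n, fun ω ↦ (f p.1 * f p.2) ω * (g p.1 * g p.2) ω := by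
      ext ω
      rw [Pi.pow_apply, hsq, Finset.sum_apply, Fintype.sum_prod_type]
    have hall : ∀ᵐ ω ∂P, ∀ p : Fin n × Fin n,
        (P[fun ω ↦ (f p.1 * f p.2) ω * (g p.1 * g p.2) ω | m₂]) ω =
          (f p.1 * f p.2) ω * ∫ x, (g p.1 * g p.2) x ∂P :=
      ae_all_iff.2 fun p ↦ (h2 p.1 p.2).2
    rw [e]
    filter_upwards [condExp_finsetSum (s := Finset.univ)
      (fun p _ ↦ (h2 (Prod.fst p) (Prod.snd p)).1) m₂, hall]
      with ω e1 e2
    rw [e1, Finset.sum_apply, ← Fintype.sum_prod_type']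
    exact Finset.sum_congr rfl fun p _ ↦ e2 p
  filter_upwards [condVar_ae_eq_condExp_sq_sub_sq_condExp hm₂ hX, hE, hE2] with ω e0 e1 e2
  rw [e0, Pi.sub_apply, Pi.pow_apply, e1, e2, pow_two, Finset.sum_mul_sum,
    ← Finset.sum_sub_distrib]
  refine Finset.sum_congr rfl fun i _ ↦ ?_
  rw [← Finset.sum_sub_distrib]
  exact Finset.sum_congr rfl fun j _ ↦ by ring

end CondVar

lemma integral_sum_mul_sum {Ω : Type*} [MeasurableSpace Ω] {P : Measure Ω} {n : ℕ}
    {X Y : Fin n → Ω → ℝ} (hX : ∀ i, MemLp (X i) 2 P) (hY : ∀ i, MemLp (Y i) 2 P)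
    (a b : Fin n → ℝ) :
    ∫ ω, (∑ i, a i * X i ω) * (∑ j, b j * Y j ω) ∂P =
      ∑ i, ∑ j, a i * b j * ∫ ω, X i ω * Y j ω ∂P := by
  have hi (i j : Fin n) : Integrable (fun ω ↦ a i * X i ω * (b j * Y j ω)) P :=
    ((hX i).const_mul (a i)).integrable_mul ((hY j).const_mul (b j))
  simp_rw [Finset.sum_mul_sum]
  rw [integral_finsetSum _ fun i _ ↦ integrable_finsetSum _ fun j _ ↦ hi i j]
  refine Finset.sum_congr rfl fun i _ ↦ ?_
  rw [integral_finsetSum _ fun j _ ↦ hi i j]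
  refine Finset.sum_congr rfl fun j _ ↦ ?_
  rw [← integral_const_mul]
  congr with ω
  ring

end

/-! ### Covariances of the residual process -/

section

variable {Ω : Type*} [MeasurableSpace Ω] {P : Measure Ω} {B : ℝ≥0 → Ω → ℝ}

/-- The process `B` indexed by the real line. -/
def realIndexed (B : ℝ≥0 → Ω → ℝ) (u : ℝ) (ω : Ω) : ℝ := B u.toNNReal ω

/-- `∫_0^1 B_u du - B_1 / 2`. -/
def bridgeArea (B : ℝ≥0 → Ω → ℝ) (ω : Ω) : ℝ := timeIntegral B 0 1 ω - B 1 ω / 2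

/-- The part of `B_u`, `u ∈ [0, 1]`, uncorrelated with `B_1` and `∫_0^1 B_v dv`. -/
def residual (B : ℝ≥0 → Ω → ℝ) (u : ℝ) (ω : Ω) : ℝ :=
  B u.toNNReal ω - u * B 1 ω - 6 * (u * (1 - u)) * bridgeArea B ω

section Covariance

variable (hB : IsBrownianReal B P)

include hB

lemma memLp_withIntegral (o : Option ℝ≥0) : MemLp (withIntegral B o) 2 P :=
  ((isGaussianProcess_withIntegral hB).hasGaussianLaw_eval o).memLp_two

lemma integral_mul_eval (s t : ℝ≥0) : ∫ ω, B s ω * B t ω ∂P = min s t := by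
  have := hB.isGaussianProcess.isProbabilityMeasure
  have h := hB.covariance_eval s t
  have hm (t : ℝ≥0) : MemLp (B t) 2 P := memLp_withIntegral hB (some t)
  rw [covariance_eq_sub (hm s) (hm t), hB.integral_eval, zero_mul, sub_zero] at h
  exact h

variable (hBm : Measurable (Function.uncurry B))

include hBm

lemma isL2Process_realIndexed : IsL2Process (realIndexed B) P where
  measurable := hBm.comp
    ((measurable_real_toNNReal.comp measurable_fst).prodMk measurable_snd)
  memLp u _ := memLp_withIntegral hB (some u.toNNReal)
  bounded := ⟨1, fun u hu ↦ by
    simp only [realIndexed, pow_two]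
    rw [integral_mul_eval hB, min_self, Real.coe_toNNReal _ hu.1.le]
    exact hu.2⟩

lemma integral_timeIntegral : ∫ ω, timeIntegral B 0 1 ω ∂P = 0 := by
  have := hB.isGaussianProcess.isProbabilityMeasure
  have h := (isL2Process_realIndexed hB hBm).integral_integral
  simp only [realIndexed, hB.integral_eval, intervalIntegral.integral_zero] at h
  simpa only [timeIntegral_zero_one] using h

lemma integral_mul_timeIntegral {u : ℝ} (hu : u ∈ Set.Icc (0 : ℝ) 1) :
    ∫ ω, B u.toNNReal ω * timeIntegral B 0 1 ω ∂P = u - u ^ 2 / 2 := by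
  have := hB.isGaussianProcess.isProbabilityMeasure
  have h := (IsL2Process.const (measurable_eval_of_uncurry hBm u.toNNReal)
    (memLp_withIntegral hB (some u.toNNReal))).integral_integral_mul
    (isL2Process_realIndexed hB hBm)
  simp only [realIndexed, integral_mul_eval hB, intervalIntegral.integral_const, sub_zero,
    smul_eq_mul, one_mul] at h
  simp only [timeIntegral_zero_one, h]
  rw [← integral_min hu]
  refine integral_congr_zero_one fun v hv ↦ ?_
  rw [NNReal.coe_min, Real.coe_toNNReal _ hu.1, Real.coe_toNNReal _ hv.1]

lemma integral_timeIntegral_mul_timeIntegral :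
    ∫ ω, timeIntegral B 0 1 ω * timeIntegral B 0 1 ω ∂P = 1 / 3 := by
  have := hB.isGaussianProcess.isProbabilityMeasure
  have hL := isL2Process_realIndexed hB hBm
  have h := hL.integral_integral_mul hL
  simp only [realIndexed, integral_mul_eval hB] at h
  simp only [timeIntegral_zero_one, h]
  have e : ∀ u ∈ Set.Icc (0 : ℝ) 1, ∫ v in (0 : ℝ)..1, ((min u.toNNReal v.toNNReal : ℝ≥0) : ℝ) =
      u - u ^ 2 / 2 := fun u hu ↦ by
    rw [← integral_min hu]
    refine integral_congr_zero_one fun v hv ↦ ?_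
    rw [NNReal.coe_min, Real.coe_toNNReal _ hu.1, Real.coe_toNNReal _ hv.1]
  rw [integral_congr_zero_one e,
    integral_eq_of_forall_eq_poly 0 1 (-1 / 2) 0 0 0 0 fun v ↦ by ring]
  norm_num

/-- Covariances of linear combinations of `B_u`, `B_1` and `∫_0^1 B_v dv`. -/
lemma integral_linComb_mul_linComb {u v : ℝ} (hu : u ∈ Set.Icc (0 : ℝ) 1)
    (hv : v ∈ Set.Icc (0 : ℝ) 1) (a₀ a₁ a₂ b₀ b₁ b₂ : ℝ) :
    ∫ ω, (a₀ * B u.toNNReal ω + a₁ * B 1 ω + a₂ * timeIntegral B 0 1 ω) *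
      (b₀ * B v.toNNReal ω + b₁ * B 1 ω + b₂ * timeIntegral B 0 1 ω) ∂P =
      a₀ * (b₀ * min u v + b₁ * u + b₂ * (u - u ^ 2 / 2)) + a₁ * (b₀ * v + b₁ + b₂ / 2)
        + a₂ * (b₀ * (v - v ^ 2 / 2) + b₁ / 2 + b₂ / 3) := by
  have hmem (u : ℝ) : ∀ i, MemLp
      ((![B u.toNNReal, B 1, timeIntegral B 0 1] : Fin 3 → Ω → ℝ) i) 2 P := fun i ↦
    match i with
    | 0 => memLp_withIntegral hB (some u.toNNReal)
    | 1 => memLp_withIntegral hB (some 1)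
    | 2 => memLp_withIntegral hB none
  have h := integral_sum_mul_sum (hmem u) (hmem v) ![a₀, a₁, a₂] ![b₀, b₁, b₂]
  simp only [Fin.sum_univ_three, Matrix.cons_val_zero, Matrix.cons_val_one, Matrix.cons_val] at h
  have h1 : (1 : ℝ).toNNReal = 1 := Real.toNNReal_one
  have hA1 := integral_mul_timeIntegral hB hBm (u := 1) (by simp)
  rw [h1] at hA1
  have hA (u : ℝ) (hu : u ∈ Set.Icc (0 : ℝ) 1) := integral_mul_timeIntegral hB hBm hu
  have hA' (u : ℝ) (hu : u ∈ Set.Icc (0 : ℝ) 1) :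
      ∫ ω, timeIntegral B 0 1 ω * B u.toNNReal ω ∂P = u - u ^ 2 / 2 := by
    simp_rw [mul_comm (timeIntegral B 0 1 _)]
    exact hA u hu
  have hA1' : ∫ ω, timeIntegral B 0 1 ω * B 1 ω ∂P = 1 - 1 ^ 2 / 2 := by
    simp_rw [mul_comm (timeIntegral B 0 1 _)]
    exact hA1
  have hu1 : u.toNNReal ≤ 1 := Real.toNNReal_le_one.2 hu.2
  have hv1 : v.toNNReal ≤ 1 := Real.toNNReal_le_one.2 hv.2
  rw [h, hA1, hA1', hA u hu, hA' v hv, integral_timeIntegral_mul_timeIntegral hB hBm]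
  simp only [integral_mul_eval hB, NNReal.coe_min, NNReal.coe_one,
    Real.coe_toNNReal _ hu.1, Real.coe_toNNReal _ hv.1, min_eq_left hu.2, min_eq_right hv.2,
    min_self]
  ring

lemma integral_residual_mul_residual {u v : ℝ} (hu : u ∈ Set.Icc (0 : ℝ) 1)
    (hv : v ∈ Set.Icc (0 : ℝ) 1) :
    ∫ ω, residual B u ω * residual B v ω ∂P = bridgeKernel u v := by
  -- The coefficients expand the residual in `B_u`, `B_1` and `∫ B`, using `H = ∫ B - B_1/2`.
  have h := integral_linComb_mul_linComb hB hBm hu hv 1 (-u + 3 * (u * (1 - u)))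
    (-6 * (u * (1 - u))) 1 (-v + 3 * (v * (1 - v))) (-6 * (v * (1 - v)))
  convert h using 1
  · congr with ω
    simp only [residual, bridgeArea]
    ring
  · rw [bridgeKernel]
    ring

lemma integral_eval_one_mul_residual {u : ℝ} (hu : u ∈ Set.Icc (0 : ℝ) 1) :
    ∫ ω, B 1 ω * residual B u ω ∂P = 0 := by
  have h := integral_linComb_mul_linComb hB hBm hu hu 0 1 0 1 (-u + 3 * (u * (1 - u)))
    (-6 * (u * (1 - u)))
  convert h using 1
  · congr with ω
    simp only [residual, bridgeArea]
    ring
  · ring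

/-- This is what fixes the weight `6u(1-u)`: `H` is uncorrelated with `B_1`, has variance `1/12`,
and its covariance with `B_u` is `u(1-u)/2`. -/
lemma integral_bridgeArea_mul_residual {u : ℝ} (hu : u ∈ Set.Icc (0 : ℝ) 1) :
    ∫ ω, bridgeArea B ω * residual B u ω ∂P = 0 := by
  have h := integral_linComb_mul_linComb hB hBm hu hu 0 (-1 / 2) 1 1 (-u + 3 * (u * (1 - u)))
    (-6 * (u * (1 - u)))
  convert h using 1
  · congr with ω
    simp only [residual, bridgeArea]
    ring
  · ring

end Covariance

end

/-! ### Independence of the residual from the conditioning variables -/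

section

variable {Ω : Type*} [MeasurableSpace Ω] {P : Measure Ω} {B : ℝ≥0 → Ω → ℝ}

/-- The σ-algebra generated by the residual process on `[0, 1]`. -/
abbrev residualSigma (B : ℝ≥0 → Ω → ℝ) : MeasurableSpace Ω :=
  MeasurableSpace.comap (fun ω (u : Set.Icc (0 : ℝ) 1) ↦ residual B u ω) inferInstance

/-- The weighted integral `∫_0^1 φ(u) Z_u^k du` of a power of the residual process. -/
def residualIntegral (B : ℝ≥0 → Ω → ℝ) (φ : ℝ → ℝ) (k : ℕ) (ω : Ω) : ℝ :=
  ∫ u in (0 : ℝ)..1, φ u * residual B u ω ^ k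

section Span

lemma mem_span_withIntegral {Ω : Type*} {B : ℝ≥0 → Ω → ℝ} (o : Option ℝ≥0) :
    withIntegral B o ∈ Submodule.span ℝ (Set.range (withIntegral B)) :=
  Submodule.subset_span ⟨o, rfl⟩

lemma bridgeArea_mem_span {Ω : Type*} {B : ℝ≥0 → Ω → ℝ} :
    bridgeArea B ∈ Submodule.span ℝ (Set.range (withIntegral B)) := by
  have e : bridgeArea B = withIntegral B none - (1 / 2 : ℝ) • withIntegral B (some 1) := by
    ext ω
    simp [bridgeArea, withIntegral]
    ring
  rw [e]
  exact sub_mem (mem_span_withIntegral _) (Submodule.smul_mem _ _ (mem_span_withIntegral _))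

lemma residual_mem_span {Ω : Type*} {B : ℝ≥0 → Ω → ℝ} (u : ℝ) :
    residual B u ∈ Submodule.span ℝ (Set.range (withIntegral B)) := by
  have e : residual B u = withIntegral B (some u.toNNReal) - u • withIntegral B (some 1)
      - (6 * (u * (1 - u))) • bridgeArea B := by
    ext ω
    simp [residual, withIntegral]
  rw [e]
  exact sub_mem (sub_mem (mem_span_withIntegral _)
    (Submodule.smul_mem _ _ (mem_span_withIntegral _))) (Submodule.smul_mem _ _ bridgeArea_mem_span)

end Span

lemma measurable_bridgeArea (hBm : Measurable (Function.uncurry B)) :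
    Measurable (bridgeArea B) :=
  (measurable_timeIntegral hBm 0 1).sub ((measurable_eval_of_uncurry hBm 1).div_const 2)

lemma measurable_uncurry_residual (hBm : Measurable (Function.uncurry B)) :
    Measurable (Function.uncurry (residual B)) := by
  have h1 : Measurable fun p : ℝ × Ω ↦ B p.1.toNNReal p.2 :=
    hBm.comp ((measurable_real_toNNReal.comp measurable_fst).prodMk measurable_snd)
  have h2 : Measurable fun p : ℝ × Ω ↦ B 1 p.2 :=
    (measurable_eval_of_uncurry hBm 1).comp measurable_snd
  have h3 : Measurable fun p : ℝ × Ω ↦ bridgeArea B p.2 :=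
    (measurable_bridgeArea hBm).comp measurable_snd
  unfold Function.uncurry residual
  fun_prop

lemma measurable_residual (hBm : Measurable (Function.uncurry B)) (u : ℝ) :
    Measurable (residual B u) :=
  (measurable_uncurry_residual hBm).comp (measurable_const.prodMk measurable_id)

lemma residualSigma_le (hBm : Measurable (Function.uncurry B)) :
    residualSigma B ≤ ‹MeasurableSpace Ω› :=
  (measurable_pi_lambda (fun ω (u : Set.Icc (0 : ℝ) 1) ↦ residual B u ω)
    fun u ↦ measurable_residual hBm u).comap_le

lemma sigmaPair_le {X Y : Ω → ℝ} (hX : Measurable X) (hY : Measurable Y) :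
    sigmaPair X Y ≤ ‹MeasurableSpace Ω› :=
  (hX.prodMk hY).comap_le

section Gaussian

variable (hB : IsBrownianReal B P)

include hB

lemma integral_eq_zero_of_mem_span (hBm : Measurable (Function.uncurry B)) {X : Ω → ℝ}
    (hX : X ∈ Submodule.span ℝ (Set.range (withIntegral B))) :
    Integrable X P ∧ ∫ ω, X ω ∂P = 0 := by
  have := hB.isGaussianProcess.isProbabilityMeasure
  induction hX using Submodule.span_induction with
  | mem x h =>
    obtain ⟨o, rfl⟩ := h
    refine ⟨(memLp_withIntegral hB o).integrable one_le_two, ?_⟩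
    match o with
    | none => exact integral_timeIntegral hB hBm
    | some t => exact hB.integral_eval t
  | zero => simp
  | add x y _ _ hx hy =>
    exact ⟨hx.1.add hy.1, by
      simp only [Pi.add_apply]; rw [integral_add hx.1 hy.1, hx.2, hy.2, add_zero]⟩
  | smul a x _ hx =>
    exact ⟨hx.1.smul a, by
      simp only [Pi.smul_apply, smul_eq_mul]; rw [integral_const_mul, hx.2, mul_zero]⟩

lemma isGaussianProcess_residual : IsGaussianProcess (residual B) P :=
  isGaussianProcess_of_mem_span (isGaussianProcess_withIntegral hB) residual_mem_span

lemma hasGaussianLaw_bridgeArea : HasGaussianLaw (bridgeArea B) P :=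
  (isGaussianProcess_of_mem_span (S := Unit) (Y := fun _ ↦ bridgeArea B)
    (isGaussianProcess_withIntegral hB) fun _ ↦ bridgeArea_mem_span).hasGaussianLaw_eval ()

/-- All variables lie in the span of one Gaussian process, so vanishing cross-covariances give
independence. Any version `H` of the bridge area is admitted, because the space-time Lévy area
agrees with it only for almost every path. -/
lemma indep_residualSigma (hBm : Measurable (Function.uncurry B)) {H : Ω → ℝ}
    (hH : H =ᵐ[P] bridgeArea B) : Indep (residualSigma B) (sigmaPair (B 1) H) P := by
  have := hB.isGaussianProcess.isProbabilityMeasure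
  let X : Fin 2 → Ω → ℝ := ![B 1, bridgeArea B]
  have hXm (i : Fin 2) : X i ∈ Submodule.span ℝ (Set.range (withIntegral B)) :=
    match i with
    | 0 => mem_span_withIntegral (some 1)
    | 1 => bridgeArea_mem_span
  have hG : IsGaussianProcess
      (Sum.elim (fun u : Set.Icc (0 : ℝ) 1 ↦ residual B u) X) P :=
    isGaussianProcess_of_mem_span (isGaussianProcess_withIntegral hB) fun s ↦
      match s with
      | .inl u => residual_mem_span u
      | .inr i => hXm i
  have hmem (s) : MemLp ((Sum.elim (fun u : Set.Icc (0 : ℝ) 1 ↦ residual B u) X) s) 2 P :=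
    (hG.hasGaussianLaw_eval s).memLp_two
  have hind := hG.indepFun_of_covariance_eq_zero
    (fun u ↦ (measurable_residual hBm u).aemeasurable)
    (fun i ↦ (hmem (.inr i)).aestronglyMeasurable.aemeasurable) fun u i ↦ by
      have h := covariance_eq_sub (hmem (.inl u)) (hmem (.inr i))
      simp only [Sum.elim_inl, Sum.elim_inr] at h
      rw [h, (integral_eq_zero_of_mem_span hB hBm (residual_mem_span u)).2, zero_mul, sub_zero]
      match i with
      | 0 =>
        exact (integral_congr_ae (.of_forall fun ω ↦ mul_comm _ _)).trans
          (integral_eval_one_mul_residual hB hBm u.2)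
      | 1 =>
        exact (integral_congr_ae (.of_forall fun ω ↦ mul_comm _ _)).trans
          (integral_bridgeArea_mul_residual hB hBm u.2)
  refine IndepFun.congr (hind.comp measurable_id
    ((measurable_pi_apply (0 : Fin 2)).prodMk (measurable_pi_apply 1))) .rfl ?_
  filter_upwards [hH] with ω hω
  simp [X, hω]

lemma ae_continuous_residual : ∀ᵐ ω ∂P, Continuous fun u ↦ residual B u ω := by
  filter_upwards [hB.cont] with ω hω
  have := continuous_comp_toNNReal hω
  unfold residual
  fun_prop

/-- Trapezoidal sums use only values of the residual at times in `[0, 1]`. Their `limsup` is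
measurable everywhere, and equals the integral whenever the path is continuous. -/
lemma aestronglyMeasurable_residualIntegral {φ : ℝ → ℝ} (hφ : Continuous φ) (k : ℕ) :
    AEStronglyMeasurable[residualSigma B] (residualIntegral B φ k) P := by
  let f (n : ℕ) (ω : Ω) : ℝ := trapezoid (fun u : ℝ≥0 ↦ φ u * residual B u ω ^ k)
    (fun u ↦ (u : ℝ)) (n + 1) (uniformPartition 0 1 n)
  have hf (n : ℕ) : Measurable[residualSigma B] (f n) := by
    have hp := isPartitionSeq_uniformPartition (zero_le_one' ℝ≥0)
    have hm (i : ℕ) (hi : i ≤ n + 1) : Measurable[residualSigma B] fun ω ↦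
        φ (uniformPartition 0 1 n i) * residual B (uniformPartition 0 1 n i) ω ^ k := by
      have hmem : (uniformPartition 0 1 n i : ℝ) ∈ Set.Icc (0 : ℝ) 1 :=
        ⟨NNReal.coe_nonneg _, by exact_mod_cast (hp.mem_Icc (k := n) hi).2⟩
      have h1 : Measurable[residualSigma B] (residual B (uniformPartition 0 1 n i)) :=
        (measurable_pi_apply (⟨_, hmem⟩ : Set.Icc (0 : ℝ) 1)).comp
          (comap_measurable fun ω (u : Set.Icc (0 : ℝ) 1) ↦ residual B u ω)
      exact (h1.pow_const k).const_mul _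
    refine Finset.measurable_sum _ fun i hi ↦ ?_
    have hi := Finset.mem_range.1 hi
    exact (((hm i hi.le).add (hm (i + 1) hi)).div_const 2).mul_const _
  refine ⟨fun ω ↦ limsup (fun n ↦ f n ω) atTop, (Measurable.limsup hf).stronglyMeasurable, ?_⟩
  filter_upwards [ae_continuous_residual hB] with ω hω
  have hc : Continuous fun u : ℝ≥0 ↦ φ u * residual B u ω ^ k :=
    (hφ.comp NNReal.continuous_coe).mul ((hω.comp NNReal.continuous_coe).pow k)
  rw [(tendsto_trapezoid_timeIntegral hc).limsup_eq]
  exact integral_congr_zero_one fun u hu ↦ by rw [Real.coe_toNNReal _ hu.1]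

end Gaussian

end

/-! ### Conditional moments of the area functional on the unit interval -/

section

variable {Ω : Type*} [MeasurableSpace Ω] {P : Measure Ω} {B : ℝ≥0 → Ω → ℝ}

lemma Ioc_subset_Icc_zero_one {u : ℝ} (hu : u ∈ Set.Ioc (0 : ℝ) 1) : u ∈ Set.Icc (0 : ℝ) 1 :=
  Set.Ioc_subset_Icc_self hu

section Moments

variable (hB : IsBrownianReal B P) (hBm : Measurable (Function.uncurry B))

include hB hBm

lemma integral_residual (u : ℝ) : ∫ ω, residual B u ω ∂P = 0 :=
  (integral_eq_zero_of_mem_span hB hBm (residual_mem_span u)).2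

lemma integral_residual_mul_residual_sq {u v : ℝ} :
    ∫ ω, residual B u ω * residual B v ω ^ 2 ∂P = 0 :=
  have := hB.isGaussianProcess.isProbabilityMeasure
  (integral_mul_sq_gaussianLaw (isGaussianProcess_residual hB).hasGaussianLaw_prodMk
    (integral_residual hB hBm u) (integral_residual hB hBm v)).1

lemma integral_residual_sq {u : ℝ} (hu : u ∈ Set.Icc (0 : ℝ) 1) :
    ∫ ω, residual B u ω ^ 2 ∂P = bridgeKernel u u := by
  simp_rw [pow_two, integral_residual_mul_residual hB hBm hu hu]

lemma integral_residual_sq_mul_residual_sq {u v : ℝ} (hu : u ∈ Set.Icc (0 : ℝ) 1)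
    (hv : v ∈ Set.Icc (0 : ℝ) 1) :
    ∫ ω, residual B u ω ^ 2 * residual B v ω ^ 2 ∂P =
      bridgeKernel u u * bridgeKernel v v + 2 * bridgeKernel u v ^ 2 := by
  have := hB.isGaussianProcess.isProbabilityMeasure
  rw [(integral_mul_sq_gaussianLaw (isGaussianProcess_residual hB).hasGaussianLaw_prodMk
    (integral_residual hB hBm u) (integral_residual hB hBm v)).2,
    integral_residual_sq hB hBm hu, integral_residual_sq hB hBm hv,
    integral_residual_mul_residual hB hBm hu hv]

/-- The second moments are `φ² K(u,u)` for the first power and `3 φ² K(u,u)²` for the square, both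
continuous on a compact interval. -/
lemma isL2Process_mul_residual_pow {φ : ℝ → ℝ} (hφ : Continuous φ) {k : ℕ} (hk : k = 1 ∨ k = 2) :
    IsL2Process (fun u ω ↦ φ u * residual B u ω ^ k) P := by
  have := hB.isGaussianProcess.isProbabilityMeasure
  have hd : Continuous fun v ↦ bridgeKernel v v :=
    continuous_bridgeKernel.comp (continuous_id.prodMk continuous_id)
  have hg (u : ℝ) := (isGaussianProcess_residual hB).hasGaussianLaw_eval u
  have hbdd {X : ℝ → Ω → ℝ} {c : ℝ → ℝ} (hc : Continuous c)
      (h : ∀ u ∈ Set.Icc (0 : ℝ) 1, ∫ ω, X u ω ^ 2 ∂P = c u) :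
      ∃ C, ∀ u ∈ Set.Ioc (0 : ℝ) 1, ∫ ω, X u ω ^ 2 ∂P ≤ C := by
    obtain ⟨C, hC⟩ := (isCompact_Icc (a := (0 : ℝ)) (b := 1)).exists_bound_of_continuousOn
      hc.continuousOn
    refine ⟨C, fun u hu ↦ ?_⟩
    rw [h u (Ioc_subset_Icc_zero_one hu)]
    exact (le_abs_self _).trans (hC u (Ioc_subset_Icc_zero_one hu))
  refine ⟨(hφ.measurable.comp measurable_fst).mul
    ((measurable_uncurry_residual hBm).pow_const k), fun u _ ↦ ?_, ?_⟩
  · refine MemLp.const_mul ?_ _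
    rcases hk with rfl | rfl
    · simpa using (hg u).memLp_two
    · exact (hg u).memLp_sq
  · rcases hk with rfl | rfl
    · refine hbdd (c := fun u ↦ φ u ^ 2 * bridgeKernel u u) ((hφ.pow 2).mul hd) fun u hu ↦ ?_
      simp_rw [pow_one, mul_pow]
      rw [integral_const_mul, integral_residual_sq hB hBm hu]
    · refine hbdd (c := fun u ↦ φ u ^ 2 * (3 * bridgeKernel u u ^ 2))
        ((hφ.pow 2).mul ((hd.pow 2).const_mul 3)) fun u hu ↦ ?_
      simp_rw [mul_pow, ← pow_mul]
      rw [integral_const_mul, (integral_pow_gaussianLaw (hg u) (integral_residual hB hBm u)).2,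
        integral_residual_sq hB hBm hu]

lemma memLp_residualIntegral {φ : ℝ → ℝ} (hφ : Continuous φ) {k : ℕ} (hk : k = 1 ∨ k = 2) :
    MemLp (residualIntegral B φ k) 2 P :=
  have := hB.isGaussianProcess.isProbabilityMeasure
  (isL2Process_mul_residual_pow hB hBm hφ hk).memLp_integral

lemma integral_residualIntegral_one {φ : ℝ → ℝ} (hφ : Continuous φ) :
    ∫ ω, residualIntegral B φ 1 ω ∂P = 0 := by
  have := hB.isGaussianProcess.isProbabilityMeasure
  have h := (isL2Process_mul_residual_pow hB hBm hφ (Or.inl rfl)).integral_integral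
  simp only [pow_one, integral_const_mul, integral_residual hB hBm, mul_zero,
    intervalIntegral.integral_zero] at h
  simpa only [residualIntegral, pow_one] using h

lemma integral_residualIntegral_two :
    ∫ ω, residualIntegral B (fun _ ↦ 1 / 2) 2 ω ∂P = 1 / 30 := by
  have := hB.isGaussianProcess.isProbabilityMeasure
  have h := (isL2Process_mul_residual_pow hB hBm (φ := fun _ ↦ 1 / 2) continuous_const
    (Or.inr rfl)).integral_integral
  unfold residualIntegral
  rw [h, integral_congr_zero_one fun u hu ↦ by
    rw [integral_const_mul, integral_residual_sq hB hBm hu], intervalIntegral.integral_const_mul,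
    integral_bridgeKernel_self]
  norm_num

lemma integral_residualIntegral_mul {φ ψ : ℝ → ℝ} (hφ : Continuous φ) (hψ : Continuous ψ) {k l : ℕ}
    (hk : k = 1 ∨ k = 2) (hl : l = 1 ∨ l = 2) :
    ∫ ω, residualIntegral B φ k ω * residualIntegral B ψ l ω ∂P =
      ∫ u in (0 : ℝ)..1, ∫ v in (0 : ℝ)..1,
        φ u * ψ v * ∫ ω, residual B u ω ^ k * residual B v ω ^ l ∂P := by
  have := hB.isGaussianProcess.isProbabilityMeasure
  have h := (isL2Process_mul_residual_pow hB hBm hφ hk).integral_integral_mul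
    (isL2Process_mul_residual_pow hB hBm hψ hl)
  unfold residualIntegral
  rw [h]
  simp_rw [← integral_const_mul]
  congr with u
  congr with v
  congr with ω
  ring

lemma integral_residualIntegral_one_one {φ ψ : ℝ → ℝ} (hφ : Continuous φ) (hψ : Continuous ψ) :
    ∫ ω, residualIntegral B φ 1 ω * residualIntegral B ψ 1 ω ∂P =
      ∫ u in (0 : ℝ)..1, ∫ v in (0 : ℝ)..1, φ u * ψ v * bridgeKernel u v := by
  rw [integral_residualIntegral_mul hB hBm hφ hψ (Or.inl rfl) (Or.inl rfl)]
  refine integral_congr_zero_one fun u hu ↦ integral_congr_zero_one fun v hv ↦ ?_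
  simp_rw [pow_one, integral_residual_mul_residual hB hBm hu hv]

lemma integral_residualIntegral_one_two {φ ψ : ℝ → ℝ} (hφ : Continuous φ) (hψ : Continuous ψ) :
    ∫ ω, residualIntegral B φ 1 ω * residualIntegral B ψ 2 ω ∂P = 0 := by
  rw [integral_residualIntegral_mul hB hBm hφ hψ (Or.inl rfl) (Or.inr rfl)]
  simp_rw [pow_one, integral_residual_mul_residual_sq hB hBm]
  simp

/-- The summand `1/900` is the square of the mean `1/30`, so `11/25200` is the variance. -/
lemma integral_residualIntegral_two_two :
    ∫ ω, residualIntegral B (fun _ ↦ 1 / 2) 2 ω * residualIntegral B (fun _ ↦ 1 / 2) 2 ω ∂P =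
      1 / 900 + 11 / 25200 := by
  rw [integral_residualIntegral_mul hB hBm continuous_const continuous_const (Or.inr rfl)
    (Or.inr rfl), integral_congr_zero_one fun u hu ↦ integral_congr_zero_one fun v hv ↦ by
    rw [integral_residual_sq_mul_residual_sq hB hBm hu hv]]
  simp_rw [intervalIntegral.integral_const_mul, integral_integral_wick]
  norm_num

end Moments

/-- `½ ∫_0^1 B_u² du - ½ B_1 ∫_0^1 B_u du + B_1² / 12`. -/
def areaFunctional (B : ℝ≥0 → Ω → ℝ) (ω : Ω) : ℝ :=
  1 / 2 * timeIntegral (fun v ω ↦ B v ω ^ 2) 0 1 ω - 1 / 2 * (timeIntegral B 0 1 ω * B 1 ω)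
    + 1 / 12 * B 1 ω ^ 2

/-- After substituting `B_u = u B_1 + 6u(1-u) H + Z_u`, the coefficient of `B_1²` is `1/6 - 1/4 +
1/12 = 0`, that of `B_1 H` is `1/2 - 1/2 = 0`, and that of `H²` is `1/2 ∫ 36u²(1-u)² du = 3/5`. -/
lemma areaFunctional_eq {Ω : Type*} {B : ℝ≥0 → Ω → ℝ} {ω : Ω} (hω : Continuous (B · ω)) :
    areaFunctional B ω = 3 / 5 * bridgeArea B ω ^ 2
      + B 1 ω * residualIntegral B (fun u ↦ u) 1 ω
      + bridgeArea B ω * residualIntegral B (fun u ↦ 6 * (u * (1 - u))) 1 ω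
      + residualIntegral B (fun _ ↦ 1 / 2) 2 ω := by
  have hR : Continuous fun u ↦ residual B u ω := by
    have := continuous_comp_toNNReal hω
    unfold residual
    fun_prop
  set H := bridgeArea B ω with hH
  set w := B 1 ω with hw
  have hA : timeIntegral B 0 1 ω = H + w / 2 := by rw [hH, bridgeArea]; ring
  have hS : timeIntegral (fun v ω ↦ B v ω ^ 2) 0 1 ω =
      ∫ u in (0 : ℝ)..1, ((u * w + 6 * (u * (1 - u)) * H) ^ 2
        + (2 * w * (u * residual B u ω ^ 1)
          + (2 * H * (6 * (u * (1 - u)) * residual B u ω ^ 1)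
            + 2 * (1 / 2 * residual B u ω ^ 2)))) := by
    rw [timeIntegral_zero_one]
    refine integral_congr_zero_one fun u _ ↦ ?_
    have : B u.toNNReal ω = u * w + 6 * (u * (1 - u)) * H + residual B u ω := by
      rw [residual]; ring
    rw [this]
    ring
  have i1 : Continuous fun u ↦ (u * w + 6 * (u * (1 - u)) * H) ^ 2 := by fun_prop
  have i2 : Continuous fun u ↦ 2 * w * (u * residual B u ω ^ 1) := by fun_prop
  have i3 : Continuous fun u ↦ 2 * H * (6 * (u * (1 - u)) * residual B u ω ^ 1) := by fun_prop
  have i4 : Continuous fun u ↦ 2 * (1 / 2 * residual B u ω ^ 2) := by fun_prop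
  have i34 : Continuous fun u ↦ 2 * H * (6 * (u * (1 - u)) * residual B u ω ^ 1)
    + 2 * (1 / 2 * residual B u ω ^ 2) := i3.add i4
  have i234 : Continuous fun u ↦ 2 * w * (u * residual B u ω ^ 1)
    + (2 * H * (6 * (u * (1 - u)) * residual B u ω ^ 1)
      + 2 * (1 / 2 * residual B u ω ^ 2)) := i2.add i34
  rw [intervalIntegral.integral_add (i1.intervalIntegrable _ _) (i234.intervalIntegrable _ _),
    intervalIntegral.integral_add (i2.intervalIntegrable _ _) (i34.intervalIntegrable _ _),
    intervalIntegral.integral_add (i3.intervalIntegrable _ _) (i4.intervalIntegrable _ _),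
    intervalIntegral.integral_const_mul, intervalIntegral.integral_const_mul,
    intervalIntegral.integral_const_mul,
    integral_eq_of_forall_eq_poly 0 0 ((w + 6 * H) ^ 2) (-12 * H * (w + 6 * H)) (36 * H ^ 2) 0 0
      fun v ↦ by ring] at hS
  rw [areaFunctional, hS, hA]
  simp only [residualIntegral]
  ring

/-- Conditional mean and variance of `areaFunctional B` given `B_1` and `∫_0^1 B_u du - B_1 / 2`. -/
theorem condExp_condVar_areaFunctional (hB : IsBrownianReal B P)
    (hBm : Measurable (Function.uncurry B)) {H : Ω → ℝ} (hHm : Measurable H)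
    (hH : H =ᵐ[P] bridgeArea B) :
    MemLp (areaFunctional B) 2 P ∧
    (P[areaFunctional B | sigmaPair (B 1) H] =ᵐ[P] fun ω ↦
      1 / 30 + 3 / 5 * H ω ^ 2) ∧
    condVar (sigmaPair (B 1) H) (areaFunctional B) P =ᵐ[P] fun ω ↦
      11 / 25200 + (1 / 720 * B 1 ω ^ 2 + 1 / 700 * H ω ^ 2) := by
  have := hB.isGaussianProcess.isProbabilityMeasure
  -- `f` collects the factors known from `(B_1, H)`, `g` those depending on the residual alone.
  let f : Fin 4 → Ω → ℝ := ![fun ω ↦ 3 / 5 * H ω ^ 2, B 1, H, fun _ ↦ 1]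
  let g : Fin 4 → Ω → ℝ := ![fun _ ↦ 1, residualIntegral B (fun u ↦ u) 1,
    residualIntegral B (fun u ↦ 6 * (u * (1 - u))) 1, residualIntegral B (fun _ ↦ 1 / 2) 2]
  have hq : Continuous fun u : ℝ ↦ 6 * (u * (1 - u)) := by fun_prop
  have hB1m : Measurable (B 1) := measurable_eval_of_uncurry hBm 1
  have hp : Measurable[sigmaPair (B 1) H] fun ω ↦ (B 1 ω, H ω) :=
    comap_measurable _
  have h1 : Measurable[sigmaPair (B 1) H] (B 1) := measurable_fst.comp hp
  have h2 : Measurable[sigmaPair (B 1) H] H := measurable_snd.comp hp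
  have hHG : HasGaussianLaw H P := (hasGaussianLaw_bridgeArea hB).congr hH.symm
  have hf (i : Fin 4) : StronglyMeasurable[sigmaPair (B 1) H] (f i) :=
    match i with
    | 0 => ((h2.pow_const 2).const_mul _).stronglyMeasurable
    | 1 => h1.stronglyMeasurable
    | 2 => h2.stronglyMeasurable
    | 3 => stronglyMeasurable_const
  have hfL (i : Fin 4) : MemLp (f i) 2 P :=
    match i with
    | 0 => hHG.memLp_sq.const_mul _
    | 1 => memLp_withIntegral hB (some 1)
    | 2 => hHG.memLp_two
    | 3 => memLp_const 1
  have hg (i : Fin 4) : AEStronglyMeasurable[residualSigma B] (g i) P :=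
    match i with
    | 0 => stronglyMeasurable_const.aestronglyMeasurable
    | 1 => aestronglyMeasurable_residualIntegral hB continuous_id 1
    | 2 => aestronglyMeasurable_residualIntegral hB hq 1
    | 3 => aestronglyMeasurable_residualIntegral hB continuous_const 2
  have hgL (i : Fin 4) : MemLp (g i) 2 P :=
    match i with
    | 0 => memLp_const 1
    | 1 => memLp_residualIntegral hB hBm continuous_id (Or.inl rfl)
    | 2 => memLp_residualIntegral hB hBm hq (Or.inl rfl)
    | 3 => memLp_residualIntegral hB hBm continuous_const (Or.inr rfl)
  obtain ⟨hL, hE, hV⟩ := condExp_condVar_sum_mul (residualSigma_le hBm) (sigmaPair_le hB1m hHm)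
    (indep_residualSigma hB hBm hH) hf hfL hg hgL
  have hsum : (fun ω ↦ ∑ i, f i ω * g i ω) =ᵐ[P] areaFunctional B := by
    filter_upwards [hB.cont, hH] with ω hω hω'
    rw [areaFunctional_eq hω, ← hω']
    simp [f, g, Fin.sum_univ_four]
  have m1 := integral_residualIntegral_one hB hBm continuous_id'
  have m2 := integral_residualIntegral_one hB hBm hq
  have m3 := integral_residualIntegral_two hB hBm
  have v11 := integral_residualIntegral_one_one hB hBm continuous_id' continuous_id'
  have v12 := integral_residualIntegral_one_one hB hBm continuous_id' hq
  have v22 := integral_residualIntegral_one_one hB hBm hq hq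
  have v13 := integral_residualIntegral_one_two hB hBm continuous_id'
    (continuous_const (y := (1 / 2 : ℝ)))
  have v23 := integral_residualIntegral_one_two hB hBm hq (continuous_const (y := (1 / 2 : ℝ)))
  have v33 := integral_residualIntegral_two_two hB hBm
  rw [integral_integral_id_id] at v11
  rw [integral_integral_id_quad] at v12
  rw [integral_integral_quad_quad] at v22
  -- The variance formula sums over ordered pairs, so the transposed covariances are needed too.
  have v21 := v12
  have v31 := v13
  have v32 := v23
  simp_rw [mul_comm (residualIntegral B (fun u ↦ u) 1 _)] at v21 v31
  simp_rw [mul_comm (residualIntegral B (fun u ↦ 6 * (u * (1 - u))) 1 _)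
    (residualIntegral B (fun _ ↦ 1 / 2) 2 _)] at v32
  refine ⟨hL.ae_eq hsum, (condExp_congr_ae hsum).symm.trans (hE.trans (.of_forall fun ω ↦ ?_)),
    (condVar_congr_ae hsum).symm.trans (hV.trans (.of_forall fun ω ↦ ?_))⟩
  · simp only [f, g, Fin.sum_univ_four, Matrix.cons_val_zero, Matrix.cons_val_one,
      Matrix.cons_val, one_mul, mul_one, integral_const, probReal_univ, smul_eq_mul, m1, m2, m3]
    ring
  · simp only [f, g, Fin.sum_univ_four, Matrix.cons_val_zero, Matrix.cons_val_one,
      Matrix.cons_val, one_mul, mul_one, integral_const, probReal_univ, smul_eq_mul,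
      m1, m2, m3, v11, v12, v13, v21, v22, v23, v31, v32, v33]
    ring

end

/-! ### Brownian scaling and the two conclusions -/

section

variable {Ω : Type*}

/-- The increments of `W` on `[s, t]`, rescaled to the unit interval. -/
def rescale (W : ℝ≥0 → Ω → ℝ) (s t : ℝ≥0) (u : ℝ≥0) (ω : Ω) : ℝ :=
  (√(t - s : ℝ≥0))⁻¹ * (W (s + (t - s) * u) ω - W s ω)

section Rescale

variable {W : ℝ≥0 → Ω → ℝ} {s t : ℝ≥0} (hst : s < t)

include hst

lemma coe_sub_pos : (0 : ℝ) < (t : ℝ) - s := sub_pos.2 (NNReal.coe_lt_coe.2 hst)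

lemma increment_eq_rescale (u : ℝ≥0) (ω : Ω) :
    increment W s (s + (t - s) * u) ω = √((t : ℝ) - s) * rescale W s t u ω := by
  have h := Real.sqrt_pos.2 (coe_sub_pos hst)
  rw [rescale, increment, NNReal.coe_sub hst.le]
  field_simp

lemma increment_eq_rescale_one (ω : Ω) :
    increment W s t ω = √((t : ℝ) - s) * rescale W s t 1 ω := by
  rw [← increment_eq_rescale hst, mul_one, add_tsub_cancel_of_le hst.le]

lemma timeIntegral_eq_rescale (X : ℝ≥0 → Ω → ℝ) (ω : Ω) :
    timeIntegral X s t ω =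
      ((t : ℝ) - s) * timeIntegral (fun u ω ↦ X (s + (t - s) * u) ω) 0 1 ω := by
  have h := coe_sub_pos hst
  rw [timeIntegral_zero_one, timeIntegral]
  have := intervalIntegral.smul_integral_comp_add_mul (a := 0) (b := 1)
    (fun v : ℝ ↦ X v.toNNReal ω) ((t : ℝ) - s) (s : ℝ)
  rw [mul_zero, add_zero, mul_one, add_sub_cancel, smul_eq_mul] at this
  rw [← this]
  congr 1
  refine integral_congr_zero_one fun u hu ↦ ?_
  congr 1
  ext
  rw [Real.coe_toNNReal _ (add_nonneg s.coe_nonneg (mul_nonneg h.le hu.1))]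
  push_cast [NNReal.coe_sub hst.le, Real.coe_toNNReal _ hu.1]
  rfl

lemma timeIntegral_increment_eq_rescale (ω : Ω) :
    timeIntegral (increment W s) s t ω =
      ((t : ℝ) - s) * (√((t : ℝ) - s) * timeIntegral (rescale W s t) 0 1 ω) := by
  rw [timeIntegral_eq_rescale hst]
  simp_rw [increment_eq_rescale hst, timeIntegral, intervalIntegral.integral_const_mul]

lemma timeIntegral_sq_increment_eq_rescale (ω : Ω) :
    timeIntegral (fun v ω ↦ increment W s v ω ^ 2) s t ω =
      ((t : ℝ) - s) ^ 2 * timeIntegral (fun u ω ↦ rescale W s t u ω ^ 2) 0 1 ω := by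
  rw [timeIntegral_eq_rescale hst]
  simp_rw [increment_eq_rescale hst, mul_pow, Real.sq_sqrt (coe_sub_pos hst).le, timeIntegral,
    intervalIntegral.integral_const_mul]
  ring

lemma spaceTimeLevyArea_eq_rescale (ω : Ω) :
    spaceTimeLevyArea W s t ω = √((t : ℝ) - s) *
      timeIntegral (fun u ω ↦ rescale W s t u ω - u * rescale W s t 1 ω) 0 1 ω := by
  have h := coe_sub_pos hst
  rw [spaceTimeLevyArea, timeIntegral_eq_rescale hst, ← mul_assoc, one_div_mul_cancel h.ne',
    one_mul]
  simp_rw [increment_eq_rescale hst, increment_eq_rescale_one hst]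
  rw [timeIntegral, timeIntegral, ← intervalIntegral.integral_const_mul]
  congr with u
  push_cast [NNReal.coe_sub hst.le]
  field_simp
  ring

end Rescale

variable [MeasurableSpace Ω] {P : Measure Ω}

lemma isBrownianReal_rescale {W : ℝ≥0 → Ω → ℝ} {s t : ℝ≥0} (hst : s < t)
    (hW : IsBrownianReal W P) : IsBrownianReal (rescale W s t) P :=
  (hW.shift s).smul (c := t - s) (tsub_pos_of_lt hst).ne'

lemma measurable_rescale {W : ℝ≥0 → Ω → ℝ} (hWm : Measurable (Function.uncurry W)) (s t : ℝ≥0) :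
    Measurable (Function.uncurry (rescale W s t)) := by
  have h1 : Measurable fun p : ℝ≥0 × Ω ↦ W (s + (t - s) * p.1) p.2 :=
    hWm.comp (by fun_prop : Measurable fun p : ℝ≥0 × Ω ↦ (s + (t - s) * p.1, p.2))
  have h2 : Measurable fun p : ℝ≥0 × Ω ↦ W s p.2 :=
    (measurable_eval_of_uncurry hWm s).comp measurable_snd
  exact (h1.sub h2).const_mul _

lemma sigmaPair_le_sigmaPair {Ω : Type*} {X Y X' Y' : Ω → ℝ} (φ : ℝ × ℝ → ℝ × ℝ) (hφ : Measurable φ)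
    (h : ∀ ω, (X' ω, Y' ω) = φ (X ω, Y ω)) : sigmaPair X' Y' ≤ sigmaPair X Y := by
  refine Measurable.comap_le ?_
  simp_rw [h]
  exact hφ.comp (comap_measurable _)

lemma sigmaPair_const_mul {Ω : Type*} (X Y : Ω → ℝ) {c : ℝ} (hc : c ≠ 0) :
    sigmaPair (fun ω ↦ c * X ω) (fun ω ↦ c * Y ω) = sigmaPair X Y := by
  refine le_antisymm
    (sigmaPair_le_sigmaPair (fun p ↦ (c * p.1, c * p.2)) (by fun_prop) fun ω ↦ rfl)
    (sigmaPair_le_sigmaPair (fun p ↦ (c⁻¹ * p.1, c⁻¹ * p.2)) (by fun_prop) fun ω ↦ ?_)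
  simp [hc]

/-- `Y` is its own conditional expectation, so it cancels in the deviation from the conditional
mean. -/
lemma condVar_add_of_stronglyMeasurable {Ω : Type*} {m m₀ : MeasurableSpace Ω} {P : Measure[m₀] Ω}
    [IsFiniteMeasure P] (hm : m ≤ m₀) {X Y : Ω → ℝ} (hX : Integrable X P)
    (hY : StronglyMeasurable[m] Y) (hYi : Integrable Y P) :
    condVar m (fun ω ↦ X ω + Y ω) P =ᵐ[P] condVar m X P := by
  refine condExp_congr_ae ?_
  filter_upwards [condExp_add hX hYi m] with ω hω
  simp only [Pi.pow_apply, Pi.sub_apply]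
  rw [show (fun ω ↦ X ω + Y ω) = X + Y from rfl, hω,
    condExp_of_stronglyMeasurable hm hY hYi]
  simp

variable {W : ℝ≥0 → Ω → ℝ}

/-- Conditional mean and variance of the space-space-time Lévy area. -/
theorem condExp_condVar_spaceSpaceTimeLevyArea (hW : IsBrownianReal W P)
    (hWm : Measurable (Function.uncurry W)) {s t : ℝ≥0} (hst : s < t) :
    MemLp (spaceSpaceTimeLevyArea P W s t) 2 P ∧
    (P[spaceSpaceTimeLevyArea P W s t | sigmaPair (increment W s t) (spaceTimeLevyArea W s t)]
      =ᵐ[P] fun ω ↦ 1 / 30 * ((t : ℝ) - s) ^ 2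
        + 3 / 5 * ((t : ℝ) - s) * spaceTimeLevyArea W s t ω ^ 2) ∧
    (condVar (sigmaPair (increment W s t) (spaceTimeLevyArea W s t))
        (spaceSpaceTimeLevyArea P W s t) P
      =ᵐ[P] fun ω ↦ 11 / 25200 * ((t : ℝ) - s) ^ 4
        + ((t : ℝ) - s) ^ 3 * (1 / 720 * increment W s t ω ^ 2
          + 1 / 700 * spaceTimeLevyArea W s t ω ^ 2)) := by
  have := hW.isGaussianProcess.isProbabilityMeasure
  set B := rescale W s t with hBdef
  have hB : IsBrownianReal B P := isBrownianReal_rescale hst hW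
  have hBm : Measurable (Function.uncurry B) := measurable_rescale hWm s t
  have hh := coe_sub_pos hst
  have hsq : √((t : ℝ) - s) ^ 2 = (t : ℝ) - s := Real.sq_sqrt hh.le
  set H := timeIntegral (fun u ω ↦ B u ω - u * B 1 ω) 0 1 with hHdef
  have hHm : Measurable H := by
    refine measurable_timeIntegral (X := fun u ω ↦ B u ω - u * B 1 ω) (hBm.sub ?_) 0 1
    exact measurable_fst.coe_nnreal_real.mul
      ((measurable_eval_of_uncurry hBm 1).comp measurable_snd)
  -- Splitting the integral requires an integrable path, hence the restriction to continuous ones.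
  have hH : H =ᵐ[P] bridgeArea B := by
    filter_upwards [hB.cont] with ω hω
    have h1 := continuous_comp_toNNReal hω
    have e : H ω = ∫ u in (0 : ℝ)..1, (B u.toNNReal ω - u * B 1 ω) := by
      rw [hHdef, timeIntegral_zero_one]
      exact integral_congr_zero_one fun u hu ↦ by rw [Real.coe_toNNReal _ hu.1]
    rw [e, bridgeArea, timeIntegral_zero_one, intervalIntegral.integral_sub
      (h1.intervalIntegrable _ _) ((by fun_prop : Continuous fun u : ℝ ↦ u * B 1 ω).intervalIntegrable
        _ _), intervalIntegral.integral_mul_const, integral_id]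
    ring
  have hw : increment W s t = fun ω ↦ √((t : ℝ) - s) * B 1 ω :=
    funext fun ω ↦ increment_eq_rescale_one hst ω
  have hHs : spaceTimeLevyArea W s t = fun ω ↦ √((t : ℝ) - s) * H ω :=
    funext fun ω ↦ spaceTimeLevyArea_eq_rescale hst ω
  -- Each term scales as `h²`: `h` comes from each time integration or explicit time factor, and
  -- `√h` from each occurrence of the path.
  have hL : spaceSpaceTimeLevyArea P W s t =ᵐ[P] (((t : ℝ) - s) ^ 2) • areaFunctional B := by
    filter_upwards [spaceSpaceTimeLevyArea_ae_eq hWm hW.cont hst.le] with ω hω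
    rw [hω, timeIntegral_sq_increment_eq_rescale hst, timeIntegral_increment_eq_rescale hst,
      increment_eq_rescale_one hst, Pi.smul_apply, areaFunctional, smul_eq_mul]
    linear_combination (-1 / 2 * ((t : ℝ) - s) * timeIntegral (rescale W s t) 0 1 ω
      * rescale W s t 1 ω + 1 / 12 * ((t : ℝ) - s) * rescale W s t 1 ω ^ 2) * hsq
  have hσ : sigmaPair (increment W s t) (spaceTimeLevyArea W s t) = sigmaPair (B 1) H := by
    rw [hw, hHs]
    exact sigmaPair_const_mul _ _ (Real.sqrt_pos.2 hh).ne'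
  obtain ⟨hmem, hE, hV⟩ := condExp_condVar_areaFunctional hB hBm hHm hH
  rw [hσ]
  refine ⟨(hmem.const_smul _).ae_eq hL.symm, ?_, ?_⟩
  · filter_upwards [condExp_congr_ae (m := sigmaPair (B 1) H) hL,
      condExp_smul (μ := P) (((t : ℝ) - s) ^ 2) (areaFunctional B) (sigmaPair (B 1) H), hE]
      with ω e1 e2 e3
    rw [e1, e2, Pi.smul_apply, e3, hHs, smul_eq_mul]
    linear_combination (-3 / 5 * ((t : ℝ) - s) * H ω ^ 2) * hsq
  · filter_upwards [condVar_congr_ae (m := sigmaPair (B 1) H) hL,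
      condVar_smul (μ := P) (m := sigmaPair (B 1) H) (((t : ℝ) - s) ^ 2) (areaFunctional B), hV]
      with ω e1 e2 e3
    rw [e1, e2, Pi.smul_apply, e3, hHs, hw, smul_eq_mul]
    linear_combination (-((t : ℝ) - s) ^ 3 * (1 / 720 * B 1 ω ^ 2 + 1 / 700 * H ω ^ 2)) * hsq

/-- Conditional variance of `∫_0^1 W_u² du` given `W_1` and `∫_0^1 W_u du`. -/
theorem condVar_timeIntegral_sq (hW : IsBrownianReal W P)
    (hWm : Measurable (Function.uncurry W)) :
    MemLp (timeIntegral (fun u ω ↦ W u ω ^ 2) 0 1) 2 P ∧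
    (condVar (sigmaPair (W 1) (timeIntegral W 0 1)) (timeIntegral (fun u ω ↦ W u ω ^ 2) 0 1) P
      =ᵐ[P] fun ω ↦ 11 / 6300 + 1 / 180 * W 1 ω ^ 2
        + 1 / 175 * (timeIntegral W 0 1 ω - 1 / 2 * W 1 ω) ^ 2) := by
  have := hW.isGaussianProcess.isProbabilityMeasure
  have hW1 := measurable_eval_of_uncurry hWm 1
  have hA := measurable_timeIntegral hWm 0 1
  have hσ : sigmaPair (W 1) (timeIntegral W 0 1) = sigmaPair (W 1) (bridgeArea W) :=
    le_antisymm
      (sigmaPair_le_sigmaPair (fun p ↦ (p.1, p.2 + p.1 / 2)) (by fun_prop) fun ω ↦ by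
        simp [bridgeArea])
      (sigmaPair_le_sigmaPair (fun p ↦ (p.1, p.2 - p.1 / 2)) (by fun_prop) fun ω ↦ rfl)
  obtain ⟨hmem, -, hV⟩ := condExp_condVar_areaFunctional hW hWm (measurable_bridgeArea hWm) .rfl
  rw [← hσ] at hV
  -- The difference between `∫ W²` and twice the area functional.
  let Y : Ω → ℝ := fun ω ↦ timeIntegral W 0 1 ω * W 1 ω - 1 / 6 * W 1 ω ^ 2
  have hG := isGaussianProcess_withIntegral hW
  have hYL : MemLp Y 2 P := by
    have h1 := (hG.hasGaussianLaw_eval (some 1)).memLp_sq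
    have h2 := (hG.hasGaussianLaw_eval none).memLp_sq
    have h3 := (hG.hasGaussianLaw_fun_add (s := none) (t := some 1)).memLp_sq
    -- Polarization expresses the product by squares of Gaussian variables, whose
    -- square-integrability is known.
    have e : Y = fun ω ↦ 1 / 2 * (withIntegral W none ω + withIntegral W (some 1) ω) ^ 2
        - 1 / 2 * withIntegral W none ω ^ 2 - 2 / 3 * withIntegral W (some 1) ω ^ 2 := by
      ext ω
      simp only [Y, withIntegral]
      ring
    rw [e]
    exact ((h3.const_mul _).sub (h2.const_mul _)).sub (h1.const_mul _)
  have hYm : StronglyMeasurable[sigmaPair (W 1) (timeIntegral W 0 1)] Y := by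
    have hp : Measurable[sigmaPair (W 1) (timeIntegral W 0 1)]
        fun ω ↦ (W 1 ω, timeIntegral W 0 1 ω) := comap_measurable _
    exact ((by fun_prop : Measurable fun p : ℝ × ℝ ↦ p.2 * p.1 - 1 / 6 * p.1 ^ 2).comp
      hp).stronglyMeasurable
  have hS : timeIntegral (fun u ω ↦ W u ω ^ 2) 0 1 =
      fun ω ↦ ((2 : ℝ) • areaFunctional W) ω + Y ω := by
    ext ω
    simp only [Y, areaFunctional, Pi.smul_apply, smul_eq_mul]
    ring
  have h2L : MemLp ((2 : ℝ) • areaFunctional W) 2 P := hmem.const_smul 2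
  rw [hS]
  refine ⟨h2L.add hYL, ?_⟩
  filter_upwards [condVar_add_of_stronglyMeasurable (sigmaPair_le hW1 hA)
    (h2L.integrable one_le_two) hYm (hYL.integrable one_le_two),
    condVar_smul (μ := P) (m := sigmaPair (W 1) (timeIntegral W 0 1)) 2 (areaFunctional W), hV]
    with ω e1 e2 e3
  rw [e1, e2, Pi.smul_apply, e3, bridgeArea, smul_eq_mul]
  ring

end

end LevyArea

end

theorem theorem3p8 {Ω : Type*} [MeasurableSpace Ω] (P : Measure Ω) [IsProbabilityMeasure P]
    (W : ℝ≥0 → Ω → ℝ) (hW : IsBrownianReal W P) (hWm : Measurable (Function.uncurry W)) :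
    (∀ s t : ℝ≥0, s < t →
      MemLp (LevyArea.spaceSpaceTimeLevyArea P W s t) 2 P ∧
      (P[LevyArea.spaceSpaceTimeLevyArea P W s t |
          LevyArea.sigmaPair (LevyArea.increment W s t) (LevyArea.spaceTimeLevyArea W s t)]
        =ᵐ[P] fun ω ↦ 1 / 30 * ((t : ℝ) - s) ^ 2
          + 3 / 5 * ((t : ℝ) - s) * LevyArea.spaceTimeLevyArea W s t ω ^ 2) ∧
      (condVar
          (LevyArea.sigmaPair (LevyArea.increment W s t) (LevyArea.spaceTimeLevyArea W s t))
          (LevyArea.spaceSpaceTimeLevyArea P W s t) P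
        =ᵐ[P] fun ω ↦ 11 / 25200 * ((t : ℝ) - s) ^ 4
          + ((t : ℝ) - s) ^ 3 * (1 / 720 * LevyArea.increment W s t ω ^ 2
            + 1 / 700 * LevyArea.spaceTimeLevyArea W s t ω ^ 2))) ∧
    MemLp (LevyArea.timeIntegral (fun u ω ↦ W u ω ^ 2) 0 1) 2 P ∧
    (condVar (LevyArea.sigmaPair (W 1) (LevyArea.timeIntegral W 0 1))
        (LevyArea.timeIntegral (fun u ω ↦ W u ω ^ 2) 0 1) P
      =ᵐ[P] fun ω ↦ 11 / 6300 + 1 / 180 * W 1 ω ^ 2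
        + 1 / 175 * (LevyArea.timeIntegral W 0 1 ω - 1 / 2 * W 1 ω) ^ 2) :=
  ⟨fun _ _ hst ↦ LevyArea.condExp_condVar_spaceSpaceTimeLevyArea hW hWm hst,
    LevyArea.condVar_timeIntegral_sq hW hWm⟩
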